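/- For a connected surface $M$ let $F(M,n)$ be the space of ordered $n$-tuples of pairwise distinct points of $M$, let $B_n(M)=\pi_1(F(M,n)/\Sigma_n)$ be the braid group, let $P_n(M)\le B_n(M)$ be the pure braid group (the image of $\pi_1(F(M,n))$), and let $d_i\colon B_n(M)\to B_{n-1}(M)$ be the operation of removing the $i$-th strand, $1\le i\le n$ (base points being placed along, and identified along, a fixed embedded arc of $M$). Put $$\mathfrak{H}_n(M)=\{\beta\in P_n(M)\mid d_1\beta=\cdots=d_n\beta\},\qquad \mathrm{Brun}_n(M)=\{\beta\in P_n(M)\mid d_1\beta=\cdots=d_n\beta=1\}.$$ Let $M=\mathbb{R}P^2$, $n=2$. Let $\sigma_1\in B_2(\mathbb{R}P^2)$ be the half twist exchanging the two base points inside an affine chart, let $\rho\in P_2(\mathbb{R}P^2)$ be the braid whose first strand runs once around a projective line while the second strand stays fixed, and let $u=\sigma_1\rho\sigma_1^{-1}$. **Proposition.** The group $P_2(\mathbb{R}P^2)$ is isomorphic to the quaternion group of order $8$; it is generated by $\rho$ and $u$, and $\rho u\rho^{-1}=u^{-1}$, $\rho^2=u^2$. The set $\mathfrak{H}_2(\mathbb{R}P^2)$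 is a subgroup of $P_2(\mathbb{R}P^2)$; it is cyclic of order $4$ and is generated by $\rho u$. The set $\mathrm{Brun}_2(\mathbb{R}P^2)$ is a subgroup of order $2$ of $\mathfrak{H}_2(\mathbb{R}P^2)$. Moreover $B_1(\mathbb{R}P^2)=P_1(\mathbb{R}P^2)\cong\mathbb{Z}/2$, the map $d_1$ restricts to a homomorphism on $\mathfrak{H}_2(\mathbb{R}P^2)$, and the sequence $$1\to \mathrm{Brun}_2(\mathbb{R}P^2)\to \mathfrak{H}_2(\mathbb{R}P^2)\xrightarrow{\,d_1\,}P_1(\mathbb{R}P^2)\cong\mathbb{Z}/2\to 1$$ is exact. -/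

import Mathlib

open scoped LinearAlgebra.Projectivization unitInterval

noncomputable section

namespace SurfaceBraid

/-! ### Configuration spaces -/

/-- The ordered configuration space `F(M, n)` of `n` pairwise distinct points of `M`, with the
topology induced from `M ^ n`. -/
def Conf (M : Type*) (n : ℕ) : Type _ := {x : Fin n → M // Function.Injective x}

instance instTopologicalSpaceConf (M : Type*) [TopologicalSpace M] (n : ℕ) :
    TopologicalSpace (Conf M n) :=
  inferInstanceAs (TopologicalSpace {x : Fin n → M // Function.Injective x})

/-- The symmetric group permutes the labels of the points of an ordered configuration. -/
instance instMulActionConf (M : Type*) (n : ℕ) : MulAction (Equiv.Perm (Fin n)) (Conf M n) where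
  smul g x := ⟨fun k => x.1 (g⁻¹ k), x.2.comp (g⁻¹).injective⟩
  one_smul _ := rfl
  mul_smul _ _ _ := rfl

theorem smul_conf_apply {M : Type*} {n : ℕ} (g : Equiv.Perm (Fin n)) (x : Conf M n) (k : Fin n) :
    (g • x).1 k = x.1 (g⁻¹ k) := rfl

/-- The unordered configuration space `F(M, n) / Σ_n`, with the quotient topology. -/
def UConf (M : Type*) (n : ℕ) : Type _ :=
  MulAction.orbitRel.Quotient (Equiv.Perm (Fin n)) (Conf M n)

instance instTopologicalSpaceUConf (M : Type*) [TopologicalSpace M] (n : ℕ) :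
    TopologicalSpace (UConf M n) :=
  inferInstanceAs (TopologicalSpace (Quotient (MulAction.orbitRel (Equiv.Perm (Fin n)) (Conf M n))))

/-- The projection `F(M, n) → F(M, n) / Σ_n`. -/
def proj (M : Type*) [TopologicalSpace M] (n : ℕ) : C(Conf M n, UConf M n) where
  toFun := Quotient.mk (MulAction.orbitRel (Equiv.Perm (Fin n)) (Conf M n))
  continuous_toFun := continuous_quotient_mk'

theorem proj_eq_iff {M : Type*} [TopologicalSpace M] {n : ℕ} {x y : Conf M n} :
    proj M n x = proj M n y ↔ x ∈ MulAction.orbit (Equiv.Perm (Fin n)) y :=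
  Quotient.eq''

/-- For a Hausdorff space `M`, the projection `F(M, n) → F(M, n) / Σ_n` is a covering with
group `Σ_n`. -/
theorem isQuotientCoveringMap_proj (M : Type*) [TopologicalSpace M] [T2Space M] (n : ℕ) :
    IsQuotientCoveringMap (proj M n) (Equiv.Perm (Fin n)) where
  toIsQuotientMap := isQuotientMap_quotient_mk'
  continuous_const_smul g := by
    refine Continuous.subtype_mk ?_ _
    exact continuous_pi fun k => (continuous_apply (g⁻¹ k)).comp continuous_subtype_val
  apply_eq_iff_mem_orbit := proj_eq_iff
  disjoint e := by
    obtain ⟨U, hU, hd⟩ := (Set.finite_range e.1).t2_separation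
    refine ⟨{x | ∀ k, x.1 k ∈ U (e.1 k)}, ?_, ?_⟩
    · have h1 : IsOpen {x : Conf M n | ∀ k, x.1 k ∈ U (e.1 k)} := by
        simp only [Set.ofPred_forall]
        exact isOpen_iInter_of_finite fun k =>
          (hU (e.1 k)).2.preimage ((continuous_apply k).comp continuous_subtype_val)
      exact h1.mem_nhds fun k => (hU (e.1 k)).1
    · rintro g ⟨_, ⟨x, hx, rfl⟩, hgx⟩
      have key : ∀ k, g⁻¹ k = k := by
        intro k
        by_contra hne
        have h2 : x.1 (g⁻¹ k) ∈ U (e.1 (g⁻¹ k)) := hx _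
        have h3 : x.1 (g⁻¹ k) ∈ U (e.1 k) := hgx k
        have h4 := hd (Set.mem_range_self (g⁻¹ k)) (Set.mem_range_self k)
          (fun h => hne (e.2 h))
        exact Set.disjoint_left.1 h4 h2 h3
      have h5 : g⁻¹ = 1 := Equiv.ext key
      exact inv_eq_one.1 h5

/-! ### Base points -/

/-- An embedded line in `M`, along which the base points of the strands are placed. -/
structure BaseArc (M : Type*) [TopologicalSpace M] where
  toFun : ℝ → M
  continuous_toFun : Continuous toFun
  injective_toFun : Function.Injective toFun

variable {M : Type*} [TopologicalSpace M]

/-- The base configuration `(p_0, …, p_{n-1})`, where `p_k` is the point of the arc with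
parameter `k`. -/
def BaseArc.base (e : BaseArc M) (n : ℕ) : Conf M n :=
  ⟨fun k => e.toFun (k : ℕ),
    fun _ _ h => Fin.ext (Nat.cast_injective (e.injective_toFun h))⟩

/-- Forgetting the `i`-th point of an ordered configuration. -/
def forget {n : ℕ} (i : Fin (n + 1)) : C(Conf M (n + 1), Conf M n) where
  toFun x := ⟨fun k => x.1 (i.succAbove k), x.2.comp Fin.succAbove_right_injective⟩
  continuous_toFun := by
    refine Continuous.subtype_mk ?_ _
    exact continuous_pi fun k => (continuous_apply (i.succAbove k)).comp continuous_subtype_val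

/-- The path that moves the configuration `(p_0, …, p_n)` without `p_j` along the arc, in an order
preserving way, to the configuration `(p_0, …, p_{n-1})`. -/
def BaseArc.shift (e : BaseArc M) {n : ℕ} (j : Fin (n + 1)) :
    Path (forget j (e.base (n + 1))) (e.base n) where
  toFun t := ⟨fun k => e.toFun ((1 - (t : ℝ)) * ((j.succAbove k : Fin (n + 1)) : ℕ)
      + (t : ℝ) * (k : ℕ)), by
    have hm : StrictMono fun k : Fin n =>
        (1 - (t : ℝ)) * ((j.succAbove k : Fin (n + 1)) : ℕ) + (t : ℝ) * ((k : ℕ) : ℝ) := by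
      intro a b hab
      have h1 : (((j.succAbove a : Fin (n + 1)) : ℕ) : ℝ) < ((j.succAbove b : Fin (n + 1)) : ℕ) :=
        Nat.cast_lt.2 (Fin.strictMono_succAbove j hab)
      have h2 : ((a : ℕ) : ℝ) < (b : ℕ) := Nat.cast_lt.2 hab
      have ht0 : (0 : ℝ) ≤ t := t.2.1
      have ht1 : (t : ℝ) ≤ 1 := t.2.2
      change (1 - (t : ℝ)) * ((j.succAbove a : Fin (n + 1)) : ℕ) + (t : ℝ) * ((a : ℕ) : ℝ)
        < (1 - (t : ℝ)) * ((j.succAbove b : Fin (n + 1)) : ℕ) + (t : ℝ) * ((b : ℕ) : ℝ)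
      rcases ht0.eq_or_lt with h | h
      · rw [← h]; linarith
      · nlinarith [mul_lt_mul_of_pos_left h2 h,
          mul_le_mul_of_nonneg_left h1.le (sub_nonneg.2 ht1)]
    exact e.injective_toFun.comp hm.injective⟩
  continuous_toFun := by
    refine Continuous.subtype_mk ?_ _
    refine continuous_pi fun k => e.continuous_toFun.comp ?_
    fun_prop
  source' := by
    refine Subtype.ext (funext fun k => ?_)
    change e.toFun _ = e.toFun _
    simp
  target' := by
    refine Subtype.ext (funext fun k => ?_)
    change e.toFun _ = e.toFun _
    simp

/-! ### Braid groups and removal of strands -/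

/-- The braid group `B_n(M) = π₁(F(M, n) / Σ_n)`. -/
abbrev BraidGroup (e : BaseArc M) (n : ℕ) : Type _ :=
  FundamentalGroup (UConf M n) (proj M n (e.base n))

/-- The pure braid group `P_n(M)`, as a subgroup of `B_n(M)`: the image of `π₁(F(M, n))`. -/
def pureBraidGroup (e : BaseArc M) (n : ℕ) : Subgroup (BraidGroup e n) :=
  (FundamentalGroup.map (proj M n) (e.base n)).range

/-- The braid represented by a geometric braid, that is, by a path of ordered configurations from
`(p_0, …, p_{n-1})` to a reordering of `(p_0, …, p_{n-1})`. -/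
def BraidGroup.ofPath {e : BaseArc M} {n : ℕ} {y : Conf M n} (γ : Path (e.base n) y)
    (hy : proj M n y = proj M n (e.base n)) : BraidGroup e n :=
  FundamentalGroup.fromPath
    (((Path.Homotopic.Quotient.mk γ).map (proj M n)).cast rfl hy.symm)

theorem exists_end (e : BaseArc M) {n : ℕ} (i : Fin (n + 1)) {q : Conf M (n + 1)}
    (hq : proj M (n + 1) q = proj M (n + 1) (e.base (n + 1))) :
    ∃ j : Fin (n + 1), q.1 i = (e.base (n + 1)).1 j := by
  obtain ⟨g, rfl⟩ := proj_eq_iff.1 hq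
  exact ⟨g⁻¹ i, rfl⟩

theorem proj_forget_eq {n : ℕ} {p q : Conf M (n + 1)} (hq : proj M (n + 1) q = proj M (n + 1) p)
    {i j : Fin (n + 1)} (h : q.1 i = p.1 j) :
    proj M n (forget i q) = proj M n (forget j p) := by
  obtain ⟨g, rfl⟩ := proj_eq_iff.1 hq
  have hj : g⁻¹ i = j := p.2 h
  have hs : ∀ a : Fin (n + 1), a ≠ i ↔ g⁻¹ a ≠ j := fun a => by
    rw [← hj, Ne, Ne, (g⁻¹).injective.eq_iff]
  let s : Equiv.Perm (Fin n) := ((finSuccAboveEquiv i).trans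
    ((g⁻¹).subtypeEquiv hs)).trans (finSuccAboveEquiv j).symm
  refine proj_eq_iff.2 ⟨s⁻¹, ?_⟩
  refine Subtype.ext (funext fun k => ?_)
  have h1 : j.succAbove (s k) = g⁻¹ (i.succAbove k) := by
    have h2 : (finSuccAboveEquiv j) (s k) = (g⁻¹).subtypeEquiv hs (finSuccAboveEquiv i k) := by
      simp [s]
    exact congrArg Subtype.val h2
  change p.1 (j.succAbove ((s⁻¹)⁻¹ k)) = p.1 (g⁻¹ (i.succAbove k))
  rw [inv_inv, h1]

/-- The operation `d_i : B_{n+1}(M) → B_n(M)` of removing the strand that starts at `p_i`.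
A braid `β` is lifted to a path of ordered configurations that starts at `(p_0, …, p_n)`, the
`i`-th point is forgotten, and the two ends of the resulting path, which are
`(p_0, …, p_n)` without `p_i` and (up to order) `(p_0, …, p_n)` without the end `p_j` of the removed
strand, are moved along the arc to `(p_0, …, p_{n-1})`. -/
def removeStrand [T2Space M] (e : BaseArc M) {n : ℕ} (i : Fin (n + 1))
    (β : BraidGroup e (n + 1)) : BraidGroup e n :=
  let cov := (isQuotientCoveringMap_proj M (n + 1)).isCoveringMap
  let b : proj M (n + 1) ⁻¹' {proj M (n + 1) (e.base (n + 1))} := ⟨e.base (n + 1), rfl⟩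
  let q := cov.monodromy (FundamentalGroup.toPath β) b
  let γ : Path.Homotopic.Quotient (e.base (n + 1)) q.1 :=
    cov.liftPathQuotient (FundamentalGroup.toPath β) b
  let j : Fin (n + 1) := (exists_end e i q.2).choose
  let δ : Path.Homotopic.Quotient (proj M n (forget i (e.base (n + 1))))
      (proj M n (forget j (e.base (n + 1)))) :=
    ((γ.map (forget i)).map (proj M n)).cast rfl
      (proj_forget_eq q.2 (exists_end e i q.2).choose_spec).symm
  FundamentalGroup.fromPath
    ((((Path.Homotopic.Quotient.mk (e.shift i)).map (proj M n)).symm.trans δ).trans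
      ((Path.Homotopic.Quotient.mk (e.shift j)).map (proj M n)))

/-- The Cohen braids: those `β` in `B_{n+1}(M)` for which all the `d_i β` are equal. -/
def cohenBraids [T2Space M] (e : BaseArc M) (n : ℕ) : Set (BraidGroup e (n + 1)) :=
  {β | ∀ i j : Fin (n + 1), removeStrand e i β = removeStrand e j β}

/-- The pure Cohen braids on `n + 1` strands. -/
def pureCohenBraids [T2Space M] (e : BaseArc M) (n : ℕ) : Set (BraidGroup e (n + 1)) :=
  cohenBraids e n ∩ pureBraidGroup e (n + 1)

/-- The pure Brunnian braids on `n + 1` strands: the intersection of the kernels of the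
`d_i : P_{n+1}(M) → P_n(M)`. -/
def pureBrunnianBraids [T2Space M] (e : BaseArc M) (n : ℕ) : Set (BraidGroup e (n + 1)) :=
  {β | β ∈ pureBraidGroup e (n + 1) ∧ ∀ i : Fin (n + 1), removeStrand e i β = 1}

/-! ### The projective plane -/

/-- The real projective plane: the lines through the origin in `ℝ³`. -/
abbrev RP2 : Type := ℙ ℝ (Fin 3 → ℝ)

/-- The quotient topology from `ℝ³ ∖ {0}`. -/
instance instTopologicalSpaceRP2 : TopologicalSpace RP2 :=
  inferInstanceAs (TopologicalSpace (Quotient (projectivizationSetoid ℝ (Fin 3 → ℝ))))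

theorem continuous_rp2_mk' : Continuous (Projectivization.mk' ℝ (V := Fin 3 → ℝ)) :=
  continuous_quotient_mk'

/-- The orthogonal projection onto a line, as a matrix. -/
def projector (x : RP2) : Fin 3 → Fin 3 → ℝ :=
  Projectivization.lift (fun v : {v : Fin 3 → ℝ // v ≠ 0} => fun i j => v.1 i * v.1 j / ∑ k, v.1 k ^ 2) (by
    rintro ⟨a, ha⟩ ⟨b, hb⟩ t h
    have h' : a = t • b := h
    subst h'
    have ht : t ≠ 0 := fun h0 => ha (by simp [h0])
    funext i j
    simp only [Pi.smul_apply, smul_eq_mul, mul_pow, ← Finset.mul_sum]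
    rw [show t * b i * (t * b j) = t ^ 2 * (b i * b j) by ring,
      mul_div_mul_left _ _ (pow_ne_zero 2 ht)]) x

theorem sum_sq_ne_zero {v : Fin 3 → ℝ} (hv : v ≠ 0) : ∑ k, v k ^ 2 ≠ 0 := fun h =>
  hv (funext fun k => by
    have := (Finset.sum_eq_zero_iff_of_nonneg fun k _ => sq_nonneg (v k)).1 h k (Finset.mem_univ k)
    simpa using this)

theorem continuous_projector : Continuous projector := by
  refine Continuous.quotient_lift ?_ _
  refine continuous_pi fun i => continuous_pi fun j => ?_
  have hc : ∀ k, Continuous fun v : {v : Fin 3 → ℝ // v ≠ 0} => v.1 k := fun k =>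
    (continuous_apply k).comp continuous_subtype_val
  exact ((hc i).mul (hc j)).div (continuous_finsetSum _ fun k _ => (hc k).pow 2)
    fun v => sum_sq_ne_zero v.2

theorem injective_projector : Function.Injective projector := by
  intro x y
  refine Projectivization.ind (fun v hv => ?_) x
  refine Projectivization.ind (fun w hw => ?_) y
  intro h
  obtain ⟨j, hj⟩ := Function.ne_iff.1 hv
  have hj' : v j ≠ 0 := hj
  refine (Projectivization.mk_eq_mk_iff' ℝ v w hv hw).2
    ⟨(∑ k, v k ^ 2) / v j * (w j / ∑ k, w k ^ 2), funext fun i => ?_⟩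
  have h1 : v i * v j / ∑ k, v k ^ 2 = w i * w j / ∑ k, w k ^ 2 := congrFun (congrFun h i) j
  have hv2 := sum_sq_ne_zero hv
  have hw2 := sum_sq_ne_zero hw
  simp only [Pi.smul_apply, smul_eq_mul]
  calc (∑ k, v k ^ 2) / v j * (w j / ∑ k, w k ^ 2) * w i
      = (∑ k, v k ^ 2) / v j * (w i * w j / ∑ k, w k ^ 2) := by ring
    _ = v i := by rw [← h1]; field_simp

instance instT2SpaceRP2 : T2Space RP2 :=
  T2Space.of_injective_continuous injective_projector continuous_projector

/-- The point `[1 : a : b]` of the affine chart `x₀ ≠ 0`. -/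
def affinePoint (a b : ℝ) : RP2 :=
  Projectivization.mk ℝ ![1, a, b] fun h => one_ne_zero (congrFun h 0)

theorem affinePoint_inj {a b c d : ℝ} (h : affinePoint a b = affinePoint c d) :
    a = c ∧ b = d := by
  obtain ⟨t, ht⟩ := (Projectivization.mk_eq_mk_iff' ℝ _ _ _ _).1 h
  have h0 : t = 1 := by simpa using congrFun ht 0
  have h1 := congrFun ht 1
  have h2 := congrFun ht 2
  simp [h0] at h1 h2
  exact ⟨h1.symm, h2.symm⟩

theorem continuous_affinePoint {X : Type*} [TopologicalSpace X] {f g : X → ℝ}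
    (hf : Continuous f) (hg : Continuous g) : Continuous fun x => affinePoint (f x) (g x) := by
  refine continuous_rp2_mk'.comp (Continuous.subtype_mk ?_ _)
  refine continuous_pi fun k => ?_
  fin_cases k
  · exact continuous_const
  · exact hf
  · exact hg

/-- The affine line of points `[1 : t : 0]`. -/
def rp2Arc : BaseArc RP2 where
  toFun t := affinePoint t 0
  continuous_toFun := continuous_affinePoint continuous_id continuous_const
  injective_toFun _ _ h := (affinePoint_inj h).1

/-- The exchange of the points `p_0 = [1 : 0 : 0]` and `p_1 = [1 : 1 : 0]` by a half turn about
the midpoint `[1 : 1/2 : 0]` in the affine chart. -/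
def sigmaPath : Path (rp2Arc.base 2) ((Equiv.swap 0 1 : Equiv.Perm (Fin 2)) • rp2Arc.base 2) where
  toFun t := ⟨![affinePoint ((1 - Real.cos (Real.pi * t)) / 2) (-Real.sin (Real.pi * t) / 2),
      affinePoint ((1 + Real.cos (Real.pi * t)) / 2) (Real.sin (Real.pi * t) / 2)], by
    have hne : affinePoint ((1 - Real.cos (Real.pi * t)) / 2) (-Real.sin (Real.pi * t) / 2) ≠
        affinePoint ((1 + Real.cos (Real.pi * t)) / 2) (Real.sin (Real.pi * t) / 2) := by
      intro h
      obtain ⟨h1, h2⟩ := affinePoint_inj h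
      nlinarith [Real.sin_sq_add_cos_sq (Real.pi * t)]
    intro a b hab
    fin_cases a <;> fin_cases b
    · rfl
    · exact absurd hab hne
    · exact absurd hab.symm hne
    · rfl⟩
  continuous_toFun := by
    refine Continuous.subtype_mk (continuous_pi fun k => ?_) _
    fin_cases k
    · exact continuous_affinePoint (by fun_prop) (by fun_prop)
    · exact continuous_affinePoint (by fun_prop) (by fun_prop)
  source' := by
    refine Subtype.ext (funext fun k => ?_)
    fin_cases k <;> simp [BaseArc.base, rp2Arc]
  target' := by
    refine Subtype.ext (funext fun k => ?_)
    rw [smul_conf_apply, Equiv.swap_inv]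
    fin_cases k <;> simp [BaseArc.base, rp2Arc]

/-- The point `p_0 = [1 : 0 : 0]` runs once around the projective line of the points
`[cos : 0 : sin]`, while `p_1 = [1 : 1 : 0]` rests. -/
def rhoPath : Path (rp2Arc.base 2) (rp2Arc.base 2) where
  toFun t := ⟨![Projectivization.mk ℝ ![Real.cos (Real.pi * t), 0, Real.sin (Real.pi * t)]
      (fun h => by
        have h0 : Real.cos (Real.pi * t) = 0 := congrFun h 0
        have h2 : Real.sin (Real.pi * t) = 0 := congrFun h 2
        nlinarith [Real.sin_sq_add_cos_sq (Real.pi * t)]),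
      affinePoint 1 0], by
    have hne : ∀ (c s : ℝ) (hv : ![c, 0, s] ≠ 0),
        Projectivization.mk ℝ ![c, 0, s] hv ≠ affinePoint 1 0 := by
      intro c s hv h
      obtain ⟨r, hr⟩ := (Projectivization.mk_eq_mk_iff' ℝ _ _ _ _).1 h
      have h1 := congrFun hr 1
      simp at h1
      exact hv (by rw [← hr, h1, zero_smul])
    intro a b hab
    fin_cases a <;> fin_cases b
    · rfl
    · exact absurd hab (hne _ _ _)
    · exact absurd hab.symm (hne _ _ _)
    · rfl⟩
  continuous_toFun := by
    refine Continuous.subtype_mk (continuous_pi fun k => ?_) _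
    fin_cases k
    · refine continuous_rp2_mk'.comp (Continuous.subtype_mk ?_ _)
      refine continuous_pi fun l => ?_
      fin_cases l
      · change Continuous fun t : I => Real.cos (Real.pi * t)
        fun_prop
      · exact continuous_const
      · change Continuous fun t : I => Real.sin (Real.pi * t)
        fun_prop
    · exact continuous_const
  source' := by
    refine Subtype.ext (funext fun k => ?_)
    fin_cases k <;> simp [BaseArc.base, rp2Arc, affinePoint]
  target' := by
    refine Subtype.ext (funext fun k => ?_)
    fin_cases k
    · refine (Projectivization.mk_eq_mk_iff' ℝ _ _ _ _).2 ⟨-1, ?_⟩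
      simp
    · simp [BaseArc.base, rp2Arc]

/-- The half twist `σ₁` in `B_2(ℝP²)`. -/
def sigma : BraidGroup rp2Arc 2 :=
  BraidGroup.ofPath sigmaPath (proj_eq_iff.2 ⟨(Equiv.swap 0 1 : Equiv.Perm (Fin 2)), rfl⟩)

/-- The braid `ρ` in `B_2(ℝP²)`: the first strand runs once along a projective line. -/
def rho : BraidGroup rp2Arc 2 := BraidGroup.ofPath rhoPath rfl

/-- The braid `u = σ₁ ρ σ₁⁻¹` in `B_2(ℝP²)`. -/
def u : BraidGroup rp2Arc 2 := sigma * rho * sigma⁻¹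

end SurfaceBraid

end

/-!
The configuration space `F(ℝP², 2) / Σ₂` has a simply connected covering that is easy to write
down. Two distinct lines in `ℝ³` are, up to a rotation, the lines spanned by `i + t j` and `t i + j`
in the space of imaginary quaternions, for some `t` with `-1 < t < 1`: the rotation takes the
bisectors `i + j` and `i - j` to those of the two given lines. As unit quaternions act on imaginary
quaternions by rotations,
`(q, t) ↦ (ℝ q (i + t j) q⁻¹, ℝ q (t i + j) q⁻¹)` maps `S³ × (-1, 1)` onto `F(ℝP², 2)`. Two pairs
`(q, t)` give the same unordered pair of lines if and only if they differ by the right action of a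
generalized quaternion group of order `16` of unit quaternions, combined with sign changes of `t`
(`frameConf`, `isQuotientCoveringMap_frame`). Since spheres of dimension at least `2` are simply
connected (`simplyConnectedSpace_sphere`), `B_2(ℝP²)` is isomorphic to this group (`deck`), and the
pure braids correspond to the elements that do not exchange the two lines, which form a quaternion
group of order `8` (`mem_pureBraidGroup_iff`).

In the same way `B_1(ℝP²)` is `{±1}`, through the antipodal covering `S² → ℝP²` (`signEquiv`). The
directions of the two lines of a frame are maps from `S³ × (-1, 1)` to `S²`, so that a pure braid
with its `i`-th strand removed is the sign by which its deck transformation acts on the direction of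
the other line (`signEquiv_removeStrand`). Everything else is computed in the group of order `16`,
once the images of `ρ` and `u` are known up to sign: those of `ρ` are determined by the two signs,
and `σ₁` only has to be known not to be pure. The Cohen braids are those whose two signs agree, the
Brunnian braids those whose two signs are `1`.
-/

noncomputable section
/-! ### Spheres are simply connected -/

section Sphere

open Metric Module

variable {E : Type*} [NormedAddCommGroup E] [InnerProductSpace ℝ E]

/-- A loop in the unit sphere that misses a point lies in the domain of a stereographic
projection, hence is null-homotopic. -/
theorem Path.homotopic_refl_of_sphere_avoids {x : sphere (0 : E) 1} (γ : Path x x)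
    (v : sphere (0 : E) 1) (hv : ∀ t, γ t ≠ v) : γ.Homotopic (Path.refl x) := by
  have hv1 : ‖(v : E)‖ = 1 := norm_eq_of_mem_sphere v
  let s := stereographic hv1
  have hsrc : ∀ t, γ t ∈ s.source := fun t => by
    rw [stereographic_source]
    exact hv t
  have hs : Continuous s.symm := (isOpenEmbedding_stereographic_symm hv1).continuous
  have hx : s.symm (s x) = x := s.left_inv (by simpa using hsrc 0)
  let δ : Path (s x) (s x) :=
    { toFun := fun t => s (γ t)
      continuous_toFun := s.continuousOn.comp_continuous γ.continuous hsrc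
      source' := by simp
      target' := by simp }
  have h1 : δ.Homotopic (Path.refl (s x)) := SimplyConnectedSpace.paths_homotopic _ _
  have h2 := (h1.map ⟨s.symm, hs⟩).pathCast hx.symm hx.symm
  have h3 : (δ.map hs).cast hx.symm hx.symm = γ := by
    ext t
    exact congrArg Subtype.val (s.left_inv (hsrc t))
  have h4 : ((Path.refl (s x)).map hs).cast hx.symm hx.symm = Path.refl x := by
    ext t
    exact congrArg Subtype.val hx
  rw [← h3, ← h4]
  exact h2

/-- A loop in the unit sphere is homotopic to the radial projection of any map at distance less
than `1` from it, as the straight-line homotopy misses the origin. -/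
theorem Path.homotopic_of_sphere_dist_lt {x : sphere (0 : E) 1} (γ δ : Path x x)
    (f : C(I, E)) (hf : ∀ t, ‖f t - (γ t : E)‖ < 1) (hδ : ∀ t, (δ t : E) = ‖f t‖⁻¹ • f t) :
    γ.Homotopic δ := by
  have hne : ∀ s t : I, (γ t : E) + (s : ℝ) • (f t - γ t) ≠ 0 := by
    intro s t h
    have h1 : ‖(γ t : E)‖ = 1 := norm_eq_of_mem_sphere _
    rw [add_eq_zero_iff_eq_neg.1 h, norm_neg, norm_smul, Real.norm_of_nonneg s.2.1] at h1
    nlinarith [hf t, s.2.1, s.2.2, norm_nonneg (f t - (γ t : E))]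
  have hfx : ∀ t : I, (γ t = x) → (δ t = x) → ‖f t‖⁻¹ • f t = (x : E) := fun t _ h => by
    rw [← hδ, h]
  let N : I × I → E := fun p => (γ p.2 : E) + (p.1 : ℝ) • (f p.2 - γ p.2)
  have hN : Continuous N := by fun_prop
  have hend : ∀ s t : I, γ t = x → δ t = x → ‖N (s, t)‖⁻¹ • N (s, t) = (x : E) := by
    intro s t h1 h2
    have h3 : f t = ‖f t‖ • (x : E) := by
      have h0 : ‖f t‖ ≠ 0 := fun h0 => by
        have := hne 1 t
        rw [norm_eq_zero] at h0
        simp [h0] at this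
      rw [← hfx t h1 h2, smul_smul, mul_inv_cancel₀ h0, one_smul]
    have h4 : N (s, t) = (1 + (s : ℝ) * (‖f t‖ - 1)) • (x : E) := by
      simp only [N, h1]
      conv_lhs => rw [h3]
      module
    have h5 : 0 < 1 + (s : ℝ) * (‖f t‖ - 1) := by
      have hpos : 0 < ‖f t‖ := norm_pos_iff.2 fun h0 => by
        have := hne 1 t
        simp [h0] at this
      rcases s.2.2.eq_or_lt with h | h
      · rw [h]; linarith
      · nlinarith [s.2.1]
    rw [h4, norm_smul, norm_eq_of_mem_sphere, Real.norm_of_nonneg h5.le, mul_one, smul_smul,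
      inv_mul_cancel₀ h5.ne', one_smul]
  refine ⟨⟨⟨⟨fun p => ⟨‖N p‖⁻¹ • N p, ?_⟩, ?_⟩, ?_, ?_⟩, ?_⟩⟩
  · rw [mem_sphere_zero_iff_norm, norm_smul, norm_inv, norm_norm,
      inv_mul_cancel₀ (norm_ne_zero_iff.2 (hne p.1 p.2))]
  · exact Continuous.subtype_mk
      ((hN.norm.inv₀ fun p => norm_ne_zero_iff.2 (hne p.1 p.2)).smul hN) _
  · intro t
    refine Subtype.ext ?_
    simp [N]
  · intro t
    refine Subtype.ext ?_
    simp [N, hδ]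
  · intro s t ht
    refine Subtype.ext ?_
    rcases ht with rfl | rfl
    · exact (hend s 0 γ.source δ.source).trans (congrArg Subtype.val γ.source.symm)
    · exact (hend s 1 γ.target δ.target).trans (congrArg Subtype.val γ.target.symm)

/-- The unit sphere of a real inner product space of dimension at least `3` is simply connected.
A loop is uniformly approximated by a polynomial map with the same end points, and the cone over
the image of this map, being a `C¹` image of `ℝ²`, is not the whole space. -/
theorem simplyConnectedSpace_sphere [FiniteDimensional ℝ E] (hE : 3 ≤ finrank ℝ E) :
    SimplyConnectedSpace (sphere (0 : E) 1) := by
  have hrank : 1 < Module.rank ℝ E := by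
    rw [← finrank_eq_rank]
    exact_mod_cast (by omega : 1 < finrank ℝ E)
  refine simply_connected_iff_loops_nullhomotopic.2
    ⟨isPathConnected_iff_pathConnectedSpace.1 (isPathConnected_sphere hrank 0 zero_le_one), ?_⟩
  intro x γ
  let F : C(I, E) := ⟨fun t => γ t, by fun_prop⟩
  obtain ⟨n, hn, hn0⟩ := ((Metric.tendsto_nhds.1 (bernsteinApproximation_uniform F) 1 one_pos).and
    (Filter.eventually_ne_atTop 0)).exists
  set f := bernsteinApproximation n F with hfdef
  have hf : ∀ t, ‖f t - (γ t : E)‖ < 1 := fun t => by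
    rw [← dist_eq_norm]
    exact (ContinuousMap.dist_apply_le_dist t).trans_lt hn
  have hpos : ∀ t, ‖f t‖ ≠ 0 := fun t h => by
    have h1 := hf t
    rw [norm_eq_zero.1 h, zero_sub, norm_neg, norm_eq_of_mem_sphere] at h1
    exact lt_irrefl _ h1
  have hf0 : f 0 = x := by simp [hfdef, F]
  have hf1 : f 1 = x := by simp [hfdef, F, hn0]
  have hcont : Continuous fun t => ‖f t‖⁻¹ • f t :=
    (f.continuous.norm.inv₀ hpos).smul f.continuous
  have hmem : ∀ t, ‖f t‖⁻¹ • f t ∈ sphere (0 : E) 1 := fun t => by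
    rw [mem_sphere_zero_iff_norm, norm_smul, norm_inv, norm_norm, inv_mul_cancel₀ (hpos t)]
  let δ : Path x x :=
    { toFun := fun t => ⟨‖f t‖⁻¹ • f t, hmem t⟩
      continuous_toFun := Continuous.subtype_mk hcont hmem
      source' := Subtype.ext (by simp [hf0])
      target' := Subtype.ext (by simp [hf1]) }
  refine (γ.homotopic_of_sphere_dist_lt δ f hf fun t => rfl).trans ?_
  -- the cone over the polynomial extension of `f` to the real line
  let G : ℝ × ℝ → E := fun p =>
    p.1 • ∑ k : Fin (n + 1), (bernsteinPolynomial ℝ n k).eval p.2 • F (bernstein.z k)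
  have hG : ContDiff ℝ 1 G := by
    refine contDiff_fst.smul (ContDiff.sum fun k _ => ContDiff.smul ?_ contDiff_const)
    exact ((bernsteinPolynomial ℝ n k).contDiff_aeval 1).comp contDiff_snd
  have hGf : ∀ (r : ℝ) (t : I), G (r, t) = r • f t := fun r t => by
    simp only [G, hfdef, bernsteinApproximation.apply]
    rfl
  obtain ⟨y, hy⟩ := (hG.dense_compl_range_of_finrank_lt_finrank (by simp; omega)).nonempty
  have hy0 : ‖y‖ ≠ 0 := fun h => hy ⟨(0, 0), by simp [G, norm_eq_zero.1 h]⟩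
  refine δ.homotopic_refl_of_sphere_avoids ⟨‖y‖⁻¹ • y, by
    rw [mem_sphere_zero_iff_norm, norm_smul, norm_inv, norm_norm, inv_mul_cancel₀ hy0]⟩ ?_
  intro t ht
  have ht' : ‖f t‖⁻¹ • f t = ‖y‖⁻¹ • y := congrArg Subtype.val ht
  refine hy ⟨(‖y‖ * ‖f t‖⁻¹, t), ?_⟩
  rw [hGf, mul_smul, ht', smul_smul, mul_inv_cancel₀ hy0, one_smul]

end Sphere
end

noncomputable section
/-! ### Homomorphisms out of the generalized quaternion groups -/

/-- The homomorphism from a generalized quaternion group determined by the images `x`, `y` of its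
generators `a 1` and `xa 0`. -/
def QuaternionGroup.lift {n : ℕ} {G : Type*} [Group G] (x y : G) (hx : x ^ (2 * n) = 1)
    (hy : y * y = x ^ n) (hxy : x * y = y * x⁻¹) : QuaternionGroup n →* G :=
  let φ : ZMod (2 * n) →+ Additive G :=
    ZMod.lift (2 * n) ⟨zmultiplesHom (Additive G) (Additive.ofMul x), by
      rw [zmultiplesHom_apply, natCast_zsmul, ← ofMul_pow, hx, ofMul_one]⟩
  have hφ : ∀ k : ℤ, (φ k).toMul = x ^ k := fun k => by
    simp [φ]
  have hφn : (φ n).toMul = x ^ n := by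
    rw [← zpow_natCast, ← hφ n, Int.cast_natCast]
  have hc : ∀ k : ZMod (2 * n), (φ k).toMul * y = y * (φ k).toMul⁻¹ := fun k => by
    obtain ⟨k, rfl⟩ := ZMod.intCast_surjective k
    rw [hφ, ← inv_zpow]
    exact (SemiconjBy.zpow_right (show SemiconjBy y x⁻¹ x from hxy.symm) k).symm
  { toFun := fun g => match g with
      | .a k => (φ k).toMul
      | .xa k => y * (φ k).toMul
    map_one' := by
      change (φ 0).toMul = 1
      rw [map_zero, toMul_zero]
    map_mul' := by
      have hc' : ∀ i j : ZMod (2 * n), (φ i).toMul * (y * (φ j).toMul) = y * (φ (j - i)).toMul :=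
        fun i j => by
          rw [← mul_assoc, hc, mul_assoc, sub_eq_neg_add, map_add, map_neg, toMul_add, toMul_neg]
      rintro (i | i) (j | j)
      · change (φ (i + j)).toMul = _
        rw [map_add, toMul_add]
      · exact (hc' i j).symm
      · change y * (φ (i + j)).toMul = y * (φ i).toMul * (φ j).toMul
        rw [map_add, toMul_add, mul_assoc]
      · change (φ ((n : ZMod (2 * n)) + j - i)).toMul = y * (φ i).toMul * (y * (φ j).toMul)
        rw [mul_assoc, hc', ← mul_assoc, hy, ← hφn, ← toMul_add, ← map_add, add_sub_assoc] }

theorem QuaternionGroup.lift_a_one {n : ℕ} {G : Type*} [Group G] (x y : G)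
    (hx : x ^ (2 * n) = 1) (hy : y * y = x ^ n) (hxy : x * y = y * x⁻¹) :
    QuaternionGroup.lift x y hx hy hxy (.a 1) = x := by
  change Additive.toMul (ZMod.lift (2 * n) _ 1) = x
  rw [← Int.cast_one, ZMod.lift_coe]
  simp

theorem QuaternionGroup.lift_xa_zero {n : ℕ} {G : Type*} [Group G] (x y : G)
    (hx : x ^ (2 * n) = 1) (hy : y * y = x ^ n) (hxy : x * y = y * x⁻¹) :
    QuaternionGroup.lift x y hx hy hxy (.xa 0) = y := by
  change y * Additive.toMul (ZMod.lift (2 * n) _ 0) = y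
  rw [map_zero, toMul_zero, mul_one]

namespace SurfaceBraid

open Quaternion Metric Set

/-! ### The deck group as a group of unit quaternions -/

/-- The group of unit quaternions. -/
abbrev S3 : Type := sphere (0 : ℍ[ℝ]) 1

/-- The quaternion `a + b i + c j + d k`. -/
def quat (a b c d : ℝ) : ℍ[ℝ] := ⟨a, b, c, d⟩

@[simp] theorem quat_re (a b c d : ℝ) : (quat a b c d).re = a := rfl

@[simp] theorem quat_imI (a b c d : ℝ) : (quat a b c d).imI = b := rfl

@[simp] theorem quat_imJ (a b c d : ℝ) : (quat a b c d).imJ = c := rfl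

@[simp] theorem quat_imK (a b c d : ℝ) : (quat a b c d).imK = d := rfl

theorem normSq_S3 (q : S3) : normSq (q : ℍ[ℝ]) = 1 := by
  rw [normSq_eq_norm_mul_self, norm_eq_of_mem_sphere, mul_one]

/-- A quaternion of norm `1`, as a point of the unit sphere. -/
def mkS3 (q : ℍ[ℝ]) (h : normSq q = 1) : S3 :=
  ⟨q, by
    rw [mem_sphere_zero_iff_norm]
    nlinarith [normSq_eq_norm_mul_self q, norm_nonneg q]⟩

theorem star_mul_self_S3 (q : S3) : star (q : ℍ[ℝ]) * q = 1 := by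
  rw [star_mul_self, normSq_S3, coe_one]

theorem self_mul_star_S3 (q : S3) : (q : ℍ[ℝ]) * star (q : ℍ[ℝ]) = 1 := by
  rw [self_mul_star, normSq_S3, coe_one]

theorem coe_inv_S3 (q : S3) : ((q⁻¹ : S3) : ℍ[ℝ]) = star (q : ℍ[ℝ]) := by
  rw [Metric.unitSphere.coe_inv]
  exact inv_eq_of_mul_eq_one_right (self_mul_star_S3 q)

/-- The unit quaternion `(1 + k) / √2`, of order `8`. -/
def zeta : S3 := mkS3 (quat (√2 / 2) 0 0 (√2 / 2)) (by
  rw [normSq_def']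
  norm_num [div_pow])

/-- The unit quaternion `i`. -/
def unitI : S3 := mkS3 (quat 0 1 0 0) (by rw [normSq_def']; norm_num)

theorem coe_zeta_sq : ((zeta ^ 2 : S3) : ℍ[ℝ]) = quat 0 0 0 1 := by
  rw [Metric.unitSphere.coe_pow, sq]
  ext <;> simp [zeta, mkS3]
  all_goals ring_nf; norm_num

theorem coe_zeta_pow_four : ((zeta ^ 4 : S3) : ℍ[ℝ]) = -1 := by
  rw [show zeta ^ 4 = zeta ^ 2 * zeta ^ 2 by rw [← pow_add], Metric.unitSphere.coe_mul, coe_zeta_sq]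
  ext <;> simp

/-- The embedding of the generalized quaternion group of order `16` into the unit quaternions. -/
def psi : QuaternionGroup 4 →* S3 :=
  QuaternionGroup.lift zeta unitI
    (by
      refine Subtype.ext ?_
      rw [show zeta ^ (2 * 4) = zeta ^ 4 * zeta ^ 4 by rw [← pow_add], Metric.unitSphere.coe_mul,
        coe_zeta_pow_four]
      simp)
    (by
      refine Subtype.ext ?_
      rw [coe_zeta_pow_four, Metric.unitSphere.coe_mul]
      ext <;> simp [unitI, mkS3])
    (by
      refine Subtype.ext ?_
      rw [Metric.unitSphere.coe_mul, Metric.unitSphere.coe_mul, coe_inv_S3]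
      ext <;> simp [unitI, zeta, mkS3])

theorem psi_a_one : psi (.a 1) = zeta := QuaternionGroup.lift_a_one ..

theorem psi_xa_zero : psi (.xa 0) = unitI := QuaternionGroup.lift_xa_zero ..

theorem coe_psi_a_two : (psi (.a 2) : ℍ[ℝ]) = quat 0 0 0 1 := by
  rw [show (QuaternionGroup.a 2 : QuaternionGroup 4) = .a 1 ^ 2 by decide, map_pow, psi_a_one,
    coe_zeta_sq]

theorem coe_psi_a_four : (psi (.a 4) : ℍ[ℝ]) = -1 := by
  rw [show (QuaternionGroup.a 4 : QuaternionGroup 4) = .a 1 ^ 4 by decide, map_pow, psi_a_one,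
    coe_zeta_pow_four]

/-- Every nontrivial subgroup of the deck group contains the central involution, which is sent
to `-1`. -/
theorem psi_injective : Function.Injective psi := by
  refine (injective_iff_map_eq_one psi).2 fun g hg => ?_
  by_contra hne
  have key : ∀ g : QuaternionGroup 4, g ≠ 1 → ∃ n : Fin 8, g ^ (n : ℕ) = .a 4 := by decide
  obtain ⟨n, hn⟩ := key g hne
  have h1 := coe_psi_a_four
  rw [← hn, map_pow, hg, one_pow] at h1
  have h2 := congrArg QuaternionAlgebra.re h1
  simp at h2
  norm_num at h2

/-- The sign by which the deck group acts on the parameter in `(-1, 1)`: both generators `a 1` and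
`xa 0` change the sign. -/
def chi : QuaternionGroup 4 →* ℤˣ :=
  QuaternionGroup.lift (-1) (-1) (by decide) (by decide) (by decide)

theorem chi_a_one : chi (.a 1) = -1 := QuaternionGroup.lift_a_one ..

theorem chi_xa_zero : chi (.xa 0) = -1 := QuaternionGroup.lift_xa_zero ..

/-! ### The universal cover of the two-point configuration space -/

/-- The universal cover of the space of pairs of points of `ℝP²`: unit quaternions (as frames of
`ℝ³`) together with a parameter that records the angle between two lines. -/
abbrev FrameCover : Type := S3 × Ioo (-1 : ℝ) 1

theorem unit_mul_mem_Ioo (ε : ℤˣ) {t : ℝ} (ht : t ∈ Ioo (-1 : ℝ) 1) :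
    ((ε : ℤ) : ℝ) * t ∈ Ioo (-1 : ℝ) 1 := by
  rcases Int.units_eq_one_or ε with rfl | rfl
  · simpa using ht
  · constructor <;> simp <;> linarith [ht.1, ht.2]

/-- The deck group acts on the frames by right translations with the inverses of unit quaternions,
and on the parameter by signs. -/
instance instMulActionFrameCover : MulAction (QuaternionGroup 4) FrameCover where
  smul g x := (x.1 * (psi g)⁻¹, ⟨((chi g : ℤ) : ℝ) * x.2, unit_mul_mem_Ioo _ x.2.2⟩)
  one_smul x := by
    refine Prod.ext ?_ (Subtype.ext ?_)
    · change x.1 * (psi 1)⁻¹ = x.1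
      simp
    · change ((chi 1 : ℤ) : ℝ) * x.2 = x.2
      simp
  mul_smul g h x := by
    refine Prod.ext ?_ (Subtype.ext ?_)
    · change x.1 * (psi (g * h))⁻¹ = x.1 * (psi h)⁻¹ * (psi g)⁻¹
      simp [mul_assoc]
    · change ((chi (g * h) : ℤ) : ℝ) * x.2 = ((chi g : ℤ) : ℝ) * (((chi h : ℤ) : ℝ) * x.2)
      simp [mul_assoc]

theorem smul_frameCover_fst (g : QuaternionGroup 4) (x : FrameCover) :
    (g • x).1 = x.1 * (psi g)⁻¹ := rfl

theorem smul_frameCover_snd (g : QuaternionGroup 4) (x : FrameCover) :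
    ((g • x).2 : ℝ) = ((chi g : ℤ) : ℝ) * x.2 := rfl

instance instSimplyConnectedSpaceFrameCover : SimplyConnectedSpace FrameCover := by
  have h1 : SimplyConnectedSpace S3 :=
    simplyConnectedSpace_sphere (by rw [Quaternion.finrank_eq_four]; norm_num)
  have h2 : ContractibleSpace (Ioo (-1 : ℝ) 1) :=
    (convex_Ioo (-1 : ℝ) 1).contractibleSpace ⟨0, by norm_num⟩
  have e : ContinuousMap.HomotopyEquiv FrameCover S3 :=
    ((ContinuousMap.HomotopyEquiv.refl S3).prodCongr (ContractibleSpace.hequiv_unit _).some).trans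
      (Homeomorph.prodUnique S3 Unit).toHomotopyEquiv
  exact e.simplyConnectedSpace

/-- The two standard lines in the plane spanned by `i` and `j`: they are spanned by `i + t j` and
`t i + j`. -/
def stdDir (k : Fin 2) (t : ℝ) : ℍ[ℝ] := (![quat 0 1 t 0, quat 0 t 1 0] : Fin 2 → ℍ[ℝ]) k

/-- The standard lines rotated by a unit quaternion. -/
def dir (k : Fin 2) (q : S3) (t : ℝ) : ℍ[ℝ] := q * stdDir k t * star (q : ℍ[ℝ])

/-- The vector of imaginary components of a quaternion. -/
def imVec : ℍ[ℝ] →ₗ[ℝ] (Fin 3 → ℝ) where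
  toFun w := ![w.imI, w.imJ, w.imK]
  map_add' v w := by
    ext k
    fin_cases k <;> simp
  map_smul' r w := by
    ext k
    fin_cases k <;> simp

theorem eq_of_imVec_eq {v w : ℍ[ℝ]} (hv : v.re = 0) (hw : w.re = 0) (h : imVec v = imVec w) :
    v = w := by
  have h0 := congrFun h 0
  have h1 := congrFun h 1
  have h2 := congrFun h 2
  exact QuaternionAlgebra.ext (hv.trans hw.symm) h0 h1 h2

theorem dir_re (k : Fin 2) (q : S3) (t : ℝ) : (dir k q t).re = 0 := by
  fin_cases k <;> simp [dir, stdDir] <;> ring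

theorem dir_mul_S3 (k : Fin 2) (q g : S3) (t : ℝ) :
    dir k (q * g⁻¹) t = q * (star (g : ℍ[ℝ]) * stdDir k t * g) * star (q : ℍ[ℝ]) := by
  simp only [dir, Metric.unitSphere.coe_mul, coe_inv_S3, star_mul, star_star, mul_assoc]

theorem conj_eq_iff (q : S3) {v w : ℍ[ℝ]} :
    q * v * star (q : ℍ[ℝ]) = q * w * star (q : ℍ[ℝ]) ↔ v = w := by
  refine ⟨fun h => ?_, fun h => by rw [h]⟩
  have h1 : star (q : ℍ[ℝ]) * (q * v * star (q : ℍ[ℝ])) * q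
      = star (q : ℍ[ℝ]) * (q * w * star (q : ℍ[ℝ])) * q := by rw [h]
  have h2 : ∀ x : ℍ[ℝ], star (q : ℍ[ℝ]) * (q * x * star (q : ℍ[ℝ])) * q = x := fun x => by
    rw [show star (q : ℍ[ℝ]) * (q * x * star (q : ℍ[ℝ])) * q
      = (star (q : ℍ[ℝ]) * q) * x * (star (q : ℍ[ℝ]) * q) by noncomm_ring, star_mul_self_S3,
      one_mul, mul_one]
  rwa [h2, h2] at h1

theorem dir_ne_zero (k : Fin 2) (q : S3) (t : ℝ) : dir k q t ≠ 0 := by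
  intro h
  have h1 : stdDir k t = 0 := (conj_eq_iff q).1 (by rw [mul_zero, zero_mul]; exact h)
  fin_cases k
  · exact one_ne_zero (congrArg QuaternionAlgebra.imI h1)
  · exact one_ne_zero (congrArg QuaternionAlgebra.imJ h1)

theorem imVec_dir_ne_zero (k : Fin 2) (q : S3) (t : ℝ) : imVec (dir k q t) ≠ 0 := fun h =>
  dir_ne_zero k q t (eq_of_imVec_eq (dir_re k q t) rfl (h.trans (map_zero _).symm))

theorem continuous_dir (k : Fin 2) : Continuous fun x : S3 × ℝ => dir k x.1 x.2 := by
  have h : Continuous fun t : ℝ => stdDir k t := by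
    have h1 : ∀ t, stdDir k t = stdDir k 0 + t • (stdDir k 1 - stdDir k 0) := fun t => by
      fin_cases k <;> ext <;> simp [stdDir]
    rw [funext h1]
    fun_prop
  have h3 : Continuous fun x : S3 × ℝ => (x.1 : ℍ[ℝ]) := continuous_subtype_val.comp continuous_fst
  exact (h3.mul (h.comp continuous_snd)).mul (continuous_star.comp h3)

theorem continuous_imVec : Continuous imVec := imVec.continuous_of_finiteDimensional

/-- The quaternion `(1 + k) / √2` rotates by a quarter turn about the axis `k`; together with the
sign change of the parameter, it exchanges the two lines. -/
theorem dir_smul_a_one_zero (x : FrameCover) :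
    dir 0 ((QuaternionGroup.a 1 : QuaternionGroup 4) • x).1
      ((QuaternionGroup.a 1 : QuaternionGroup 4) • x).2 = -dir 1 x.1 x.2 := by
  rw [smul_frameCover_fst, smul_frameCover_snd, dir_mul_S3, psi_a_one, chi_a_one, dir, ← neg_mul,
    ← mul_neg, conj_eq_iff]
  ext <;> simp [zeta, mkS3, stdDir] <;> ring_nf <;> norm_num
  ring

theorem dir_smul_a_one_one (x : FrameCover) :
    dir 1 ((QuaternionGroup.a 1 : QuaternionGroup 4) • x).1
      ((QuaternionGroup.a 1 : QuaternionGroup 4) • x).2 = dir 0 x.1 x.2 := by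
  rw [smul_frameCover_fst, smul_frameCover_snd, dir_mul_S3, psi_a_one, chi_a_one, dir, conj_eq_iff]
  ext <;> simp [zeta, mkS3, stdDir] <;> ring_nf <;> norm_num
  ring

/-- The quaternion `i` rotates by a half turn about the axis `i`; together with the sign change of
the parameter, it fixes the first direction and reverses the second. -/
theorem dir_smul_xa_zero_zero (x : FrameCover) :
    dir 0 ((QuaternionGroup.xa 0 : QuaternionGroup 4) • x).1
      ((QuaternionGroup.xa 0 : QuaternionGroup 4) • x).2 = dir 0 x.1 x.2 := by
  rw [smul_frameCover_fst, smul_frameCover_snd, dir_mul_S3, psi_xa_zero, chi_xa_zero, dir,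
    conj_eq_iff]
  ext <;> simp [unitI, mkS3, stdDir]

theorem dir_smul_xa_zero_one (x : FrameCover) :
    dir 1 ((QuaternionGroup.xa 0 : QuaternionGroup 4) • x).1
      ((QuaternionGroup.xa 0 : QuaternionGroup 4) • x).2 = -dir 1 x.1 x.2 := by
  rw [smul_frameCover_fst, smul_frameCover_snd, dir_mul_S3, psi_xa_zero, chi_xa_zero, dir,
    ← neg_mul, ← mul_neg, conj_eq_iff]
  ext <;> simp [unitI, mkS3, stdDir]

end SurfaceBraid
end

noncomputable section
namespace SurfaceBraid

open Quaternion Metric Set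

/-! ### The covering of the configuration spaces by frames -/

theorem rp2_mk_imVec_eq_iff {v w : ℍ[ℝ]} (hv : v.re = 0) (hw : w.re = 0) (hv0 : imVec v ≠ 0)
    (hw0 : imVec w ≠ 0) :
    Projectivization.mk ℝ (imVec v) hv0 = Projectivization.mk ℝ (imVec w) hw0 ↔
      ∃ r : ℝ, v = r • w := by
  rw [Projectivization.mk_eq_mk_iff']
  refine exists_congr fun r => ?_
  rw [← map_smul, eq_comm]
  exact ⟨fun h => eq_of_imVec_eq hv (by simp [hw]) h, fun h => by rw [h]⟩

/-- The two lines in `ℝ³` that are spanned by `dir 0 q t` and `dir 1 q t`. The parameter `t` is any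
real number here; the lines coincide for `t = 1` and for `t = -1`. -/
def lines (x : S3 × ℝ) (k : Fin 2) : RP2 :=
  Projectivization.mk ℝ (imVec (dir k x.1 x.2)) (imVec_dir_ne_zero k x.1 x.2)

theorem continuous_lines : Continuous lines :=
  continuous_pi fun k => continuous_rp2_mk'.comp
    (Continuous.subtype_mk (continuous_imVec.comp (continuous_dir k))
      fun x => imVec_dir_ne_zero k x.1 x.2)

theorem lines_eq_iff {x y : S3 × ℝ} {k l : Fin 2} :
    lines x k = lines y l ↔ ∃ r : ℝ, dir k x.1 x.2 = r • dir l y.1 y.2 :=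
  rp2_mk_imVec_eq_iff (dir_re ..) (dir_re ..) _ _

theorem lines_zero_ne_one {x : S3 × ℝ} (hx : x.2 ∈ Ioo (-1 : ℝ) 1) : lines x 0 ≠ lines x 1 := by
  intro h
  obtain ⟨r, hr⟩ := lines_eq_iff.1 h
  rw [dir, dir, ← smul_mul_assoc, ← mul_smul_comm, conj_eq_iff] at hr
  have h1 : (1 : ℝ) = r * x.2 := by simpa [stdDir] using congrArg QuaternionAlgebra.imI hr
  have h2 : x.2 = r := by simpa [stdDir] using congrArg QuaternionAlgebra.imJ hr
  rw [← h2] at h1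
  nlinarith [hx.1, hx.2]

theorem injective_lines_iff {x : S3 × ℝ} (hx : x.2 ∈ Icc (-1 : ℝ) 1) :
    Function.Injective (lines x) ↔ x.2 ∈ Ioo (-1 : ℝ) 1 := by
  constructor
  · intro h
    refine ⟨lt_of_le_of_ne hx.1 fun h1 => ?_, lt_of_le_of_ne hx.2 fun h1 => ?_⟩
    · refine zero_ne_one (h (lines_eq_iff.2 ⟨-1, ?_⟩) : (0 : Fin 2) = 1)
      rw [dir, dir, ← smul_mul_assoc, ← mul_smul_comm, conj_eq_iff, ← h1]
      ext <;> simp [stdDir]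
    · refine zero_ne_one (h (lines_eq_iff.2 ⟨1, ?_⟩) : (0 : Fin 2) = 1)
      rw [dir, dir, ← smul_mul_assoc, ← mul_smul_comm, conj_eq_iff, h1]
      ext <;> simp [stdDir]
  · intro h k l hkl
    fin_cases k <;> fin_cases l
    · rfl
    · exact absurd hkl (lines_zero_ne_one h)
    · exact absurd hkl.symm (lines_zero_ne_one h)
    · rfl

/-- The covering of the ordered configuration space of two points of `ℝP²` by frames. -/
def frameConf : C(FrameCover, Conf RP2 2) where
  toFun x := ⟨lines (x.1, x.2), (injective_lines_iff (Ioo_subset_Icc_self x.2.2)).2 x.2.2⟩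
  continuous_toFun := Continuous.subtype_mk (continuous_lines.comp
    (continuous_fst.prodMk (continuous_subtype_val.comp continuous_snd))) _

theorem frameConf_apply (x : FrameCover) (k : Fin 2) :
    (frameConf x).1 k = lines (x.1, x.2) k := rfl

theorem conf_two_ext {M : Type*} {x y : Conf M 2} (h0 : x.1 0 = y.1 0) (h1 : x.1 1 = y.1 1) :
    x = y := by
  refine Subtype.ext (funext fun k => ?_)
  fin_cases k
  · exact h0
  · exact h1

theorem frameConf_a_one_smul (x : FrameCover) :
    frameConf ((QuaternionGroup.a 1 : QuaternionGroup 4) • x) =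
      (Equiv.swap 0 1 : Equiv.Perm (Fin 2)) • frameConf x := by
  refine conf_two_ext ?_ ?_
  · rw [smul_conf_apply, Equiv.swap_inv, Equiv.swap_apply_left, frameConf_apply, frameConf_apply,
      lines_eq_iff]
    exact ⟨-1, by rw [dir_smul_a_one_zero, neg_smul, one_smul]⟩
  · rw [smul_conf_apply, Equiv.swap_inv, Equiv.swap_apply_right, frameConf_apply, frameConf_apply,
      lines_eq_iff]
    exact ⟨1, by rw [dir_smul_a_one_one, one_smul]⟩

theorem frameConf_xa_zero_smul (x : FrameCover) :
    frameConf ((QuaternionGroup.xa 0 : QuaternionGroup 4) • x) = frameConf x := by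
  refine conf_two_ext ?_ ?_
  · rw [frameConf_apply, frameConf_apply, lines_eq_iff]
    exact ⟨1, by rw [dir_smul_xa_zero_zero, one_smul]⟩
  · rw [frameConf_apply, frameConf_apply, lines_eq_iff]
    exact ⟨-1, by rw [dir_smul_xa_zero_one, neg_smul, one_smul]⟩

theorem frameConf_a_one_pow_smul (m : ℕ) (x : FrameCover) :
    frameConf ((QuaternionGroup.a 1 : QuaternionGroup 4) ^ m • x) =
      (Equiv.swap 0 1 : Equiv.Perm (Fin 2)) ^ m • frameConf x := by
  induction m with
  | zero => simp
  | succ m ih => rw [pow_succ', mul_smul, frameConf_a_one_smul, ih, pow_succ', mul_smul]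

theorem frameConf_xa_zero_pow_smul (m : ℕ) (x : FrameCover) :
    frameConf ((QuaternionGroup.xa 0 : QuaternionGroup 4) ^ m • x) = frameConf x := by
  induction m with
  | zero => simp
  | succ m ih => rw [pow_succ', mul_smul, frameConf_xa_zero_smul, ih]

/-! ### Transitivity of the deck group on the fibres -/

/-- The image of the deck group is closed under negation, and the sign of the parameter does not
distinguish an element from its negative. -/
theorem exists_psi_eq (g : QuaternionGroup 4) {w : ℍ[ℝ]}
    (h : w = psi g ∨ w = -psi g) :
    ∃ g' : QuaternionGroup 4, (psi g' : ℍ[ℝ]) = w ∧ chi g' = chi g := by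
  rcases h with h | h
  · exact ⟨g, h.symm, rfl⟩
  · refine ⟨.a 4 * g, ?_, ?_⟩
    · rw [map_mul, Metric.unitSphere.coe_mul, coe_psi_a_four, h, neg_one_mul]
    · rw [map_mul, show (QuaternionGroup.a 4 : QuaternionGroup 4) = .a 1 ^ 4 by decide, map_pow,
        chi_a_one, show ((-1 : ℤˣ)) ^ 4 = 1 by decide, one_mul]

/-- A unit quaternion whose rotation maps the coordinate axes `ℝ i` and `ℝ j` to themselves belongs
to the quaternion group of order `8`. -/
theorem exists_psi_eq_of_axes {w : ℍ[ℝ]} (hn : normSq w = 1) (l m : ℤˣ)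
    (hi : w * quat 0 1 0 0 = ((l : ℤ) : ℝ) • (quat 0 1 0 0 * w))
    (hj : w * quat 0 0 1 0 = ((m : ℤ) : ℝ) • (quat 0 0 1 0 * w)) :
    ∃ g : QuaternionGroup 4, (psi g : ℍ[ℝ]) = w ∧ chi g = l * m := by
  rw [normSq_def'] at hn
  have hi0 := congrArg QuaternionAlgebra.re hi
  have hi1 := congrArg QuaternionAlgebra.imI hi
  have hi2 := congrArg QuaternionAlgebra.imJ hi
  have hi3 := congrArg QuaternionAlgebra.imK hi
  have hj0 := congrArg QuaternionAlgebra.re hj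
  have hj1 := congrArg QuaternionAlgebra.imI hj
  have hj2 := congrArg QuaternionAlgebra.imJ hj
  have hj3 := congrArg QuaternionAlgebra.imK hj
  have hxa : (QuaternionGroup.xa 2 : QuaternionGroup 4) = .xa 0 * .a 2 := by decide
  have hpsi : (psi (.xa 2) : ℍ[ℝ]) = quat 0 0 (-1) 0 := by
    rw [hxa, map_mul, Metric.unitSphere.coe_mul, coe_psi_a_two, psi_xa_zero]
    ext <;> simp [unitI, mkS3]
  have hpsi0 : (psi (.xa 0) : ℍ[ℝ]) = quat 0 1 0 0 := by
    rw [psi_xa_zero]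
    rfl
  have hchi : chi (.a 2) = 1 := by
    rw [show (QuaternionGroup.a 2 : QuaternionGroup 4) = .a 1 ^ 2 by decide, map_pow, chi_a_one]
    decide
  have hchi' : chi (.xa 2) = -1 := by
    rw [hxa, map_mul, hchi, chi_xa_zero, mul_one]
  obtain ⟨a, b, c, d, rfl⟩ : ∃ a b c d, w = quat a b c d := ⟨w.re, w.imI, w.imJ, w.imK, rfl⟩
  rcases Int.units_eq_one_or l with rfl | rfl <;> rcases Int.units_eq_one_or m with rfl | rfl
  all_goals simp at hi0 hi1 hi2 hi3 hj0 hj1 hj2 hj3 hn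
  · obtain ⟨rfl, rfl, rfl⟩ : b = 0 ∧ c = 0 ∧ d = 0 := ⟨by linarith, by linarith, by linarith⟩
    simp at hn
    rw [mul_one, ← map_one chi]
    refine exists_psi_eq 1 ?_
    rcases hn with rfl | rfl
    · left; ext <;> simp
    · right; ext <;> simp
  · obtain ⟨rfl, rfl, rfl⟩ : a = 0 ∧ c = 0 ∧ d = 0 := ⟨by linarith, by linarith, by linarith⟩
    simp at hn
    rw [one_mul, ← chi_xa_zero]
    refine exists_psi_eq _ ?_
    rw [hpsi0]
    rcases hn with rfl | rfl
    · left; ext <;> simp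
    · right; ext <;> simp
  · obtain ⟨rfl, rfl, rfl⟩ : a = 0 ∧ b = 0 ∧ d = 0 := ⟨by linarith, by linarith, by linarith⟩
    simp at hn
    rw [mul_one, ← hchi']
    refine exists_psi_eq _ ?_
    rw [hpsi]
    rcases hn with rfl | rfl
    · right; ext <;> simp
    · left; ext <;> simp
  · obtain ⟨rfl, rfl, rfl⟩ : a = 0 ∧ b = 0 ∧ c = 0 := ⟨by linarith, by linarith, by linarith⟩
    simp at hn
    rw [show (-1 : ℤˣ) * -1 = 1 by decide, ← hchi]
    refine exists_psi_eq _ ?_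
    rw [coe_psi_a_two]
    rcases hn with rfl | rfl
    · left; ext <;> simp
    · right; ext <;> simp

theorem normSq_conj (q : S3) (w : ℍ[ℝ]) : normSq ((q : ℍ[ℝ]) * w * star (q : ℍ[ℝ])) = normSq w := by
  rw [map_mul, map_mul, normSq_star, normSq_S3, one_mul, mul_one]

/-- The parameter and the scalars are determined, up to sign, by the norms and the inner product
of the two directions. -/
theorem exists_units_of_norms {s t lam mu : ℝ} (hs : s ∈ Ioo (-1 : ℝ) 1)
    (ht : t ∈ Ioo (-1 : ℝ) 1) (h0 : 1 + s ^ 2 = lam ^ 2 * (1 + t ^ 2))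
    (h1 : 1 + s ^ 2 = mu ^ 2 * (1 + t ^ 2)) (h2 : s = lam * mu * t) :
    ∃ l m : ℤˣ, lam = ((l : ℤ) : ℝ) ∧ mu = ((m : ℤ) : ℝ) := by
  have hsq : lam ^ 2 = mu ^ 2 :=
    mul_right_cancel₀ (by positivity : (1 + t ^ 2) ≠ 0) (h0.symm.trans h1)
  have hs2 : s ^ 2 = (lam ^ 2) ^ 2 * t ^ 2 := by
    rw [h2, mul_pow, mul_pow, ← hsq]
    ring
  have hfac : (lam ^ 2 - 1) * (lam ^ 2 * t ^ 2 - 1) = 0 := by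
    rw [hs2] at h0
    linarith
  have hs1 : s ^ 2 < 1 := by nlinarith [hs.1, hs.2]
  have ht1 : t ^ 2 < 1 := by nlinarith [ht.1, ht.2]
  have hlam : lam ^ 2 = 1 := by
    rcases mul_eq_zero.1 hfac with h | h
    · linarith
    · nlinarith [sq_nonneg s, sq_nonneg t]
  have key : ∀ a : ℝ, a ^ 2 = 1 → ∃ l : ℤˣ, a = ((l : ℤ) : ℝ) := fun a ha => by
    rcases sq_eq_one_iff.1 ha with h | h
    · exact ⟨1, by simp [h]⟩
    · exact ⟨-1, by simp [h]⟩
  obtain ⟨l, hl⟩ := key lam hlam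
  obtain ⟨m, hm⟩ := key mu (hsq ▸ hlam)
  exact ⟨l, m, hl, hm⟩

/-- Two frames over the same ordered pair of lines differ by a deck transformation. The rotation
that takes one frame to the other multiplies both directions by signs, so it preserves the axes of
`i` and `j`, which are linear combinations of the two directions. -/
theorem exists_smul_eq_of_frameConf_eq {x y : FrameCover} (h : frameConf x = frameConf y) :
    ∃ g : QuaternionGroup 4, g • y = x := by
  obtain ⟨q', s, hs⟩ := x
  obtain ⟨q, t, ht⟩ := y
  obtain ⟨lam, hl⟩ := lines_eq_iff.1 (congrFun (congrArg Subtype.val h) 0)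
  obtain ⟨mu, hm⟩ := lines_eq_iff.1 (congrFun (congrArg Subtype.val h) 1)
  -- the rotation that takes one frame to the other
  obtain ⟨r, rfl⟩ : ∃ r : S3, q' = q * r := ⟨q⁻¹ * q', by rw [mul_inv_cancel_left]⟩
  have hdir : ∀ (k : Fin 2) (c : ℝ), dir k (q * r) s = c • dir k q t →
      r * stdDir k s * star (r : ℍ[ℝ]) = c • stdDir k t := by
    intro k c hc
    rw [← conj_eq_iff q, mul_smul_comm, smul_mul_assoc]
    refine Eq.trans ?_ hc
    simp only [dir, Metric.unitSphere.coe_mul, star_mul, mul_assoc]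
  have hl' := hdir 0 lam hl
  have hm' := hdir 1 mu hm
  have hnorm : ∀ v w : ℍ[ℝ], r * v * star (r : ℍ[ℝ]) = w → normSq v = normSq w :=
    fun v w hvw => by rw [← hvw, normSq_conj]
  have n0 := hnorm _ _ hl'
  have n1 := hnorm _ _ hm'
  have n2 := hnorm (stdDir 0 s + stdDir 1 s) (lam • stdDir 0 t + mu • stdDir 1 t) (by
    rw [mul_add, add_mul, hl', hm'])
  rw [normSq_def', normSq_def'] at n0 n1 n2
  simp [stdDir] at n0 n1 n2
  have hst : s = lam * mu * t := by nlinarith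
  obtain ⟨l, m, rfl, rfl⟩ := exists_units_of_norms (lam := lam) (mu := mu) hs ht
    (by linarith) (by linarith) hst
  have hcomm : ∀ v w : ℍ[ℝ], r * v * star (r : ℍ[ℝ]) = w → r * v = w * r := fun v w hvw => by
    rw [← hvw, mul_assoc, star_mul_self_S3, mul_one]
  have c0 := hcomm _ _ hl'
  have c1 := hcomm _ _ hm'
  have hs1 : 1 - s ^ 2 ≠ 0 := by nlinarith [hs.1, hs.2]
  have hll : ((l : ℤ) : ℝ) * ((l : ℤ) : ℝ) = 1 := by
    rcases Int.units_eq_one_or l with rfl | rfl <;> simp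
  have hmm : ((m : ℤ) : ℝ) * ((m : ℤ) : ℝ) = 1 := by
    rcases Int.units_eq_one_or m with rfl | rfl <;> simp
  have hs2 : s ^ 2 = t ^ 2 := by
    rw [hst, mul_pow, mul_pow, sq, sq, hll, hmm]
    ring
  -- the axes of `i` and `j` in terms of the two directions
  have hI : ∀ a : ℝ, (1 - a ^ 2) • quat 0 1 0 0 = stdDir 0 a - a • stdDir 1 a := fun a => by
    ext <;> simp [stdDir]
    ring
  have hJ : ∀ a : ℝ, (1 - a ^ 2) • quat 0 0 1 0 = stdDir 1 a - a • stdDir 0 a := fun a => by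
    ext <;> simp [stdDir]
    ring
  have hsm : s * m = t * l := by
    rw [hst]
    linear_combination (l : ℤ) * t * hmm
  have hsl : s * l = t * m := by
    rw [hst]
    linear_combination (m : ℤ) * t * hll
  obtain ⟨g, hg, hchi⟩ := exists_psi_eq_of_axes (normSq_S3 r) l m
    (smul_right_injective _ hs1 (by
      change (1 - s ^ 2) • ((r : ℍ[ℝ]) * _) = (1 - s ^ 2) • _
      rw [← mul_smul_comm, smul_comm, hI, hs2, ← smul_mul_assoc, hI, mul_sub, mul_smul_comm, c0, c1,
        ← smul_mul_assoc, ← sub_mul, ← smul_mul_assoc, smul_smul, hsm, smul_sub, smul_smul,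
        mul_comm t]))
    (smul_right_injective _ hs1 (by
      change (1 - s ^ 2) • ((r : ℍ[ℝ]) * _) = (1 - s ^ 2) • _
      rw [← mul_smul_comm, smul_comm, hJ, hs2, ← smul_mul_assoc, hJ, mul_sub, mul_smul_comm, c0, c1,
        ← smul_mul_assoc, ← sub_mul, ← smul_mul_assoc, smul_smul, hsl, smul_sub, smul_smul,
        mul_comm t]))
  refine ⟨g⁻¹, Prod.ext ?_ (Subtype.ext ?_)⟩
  · rw [smul_frameCover_fst, map_inv, inv_inv]
    exact congrArg (q * ·) (Subtype.ext hg)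
  · rw [smul_frameCover_snd, map_inv, hchi, Int.units_inv_eq_self]
    exact (by simpa using hst.symm)

end SurfaceBraid
end

noncomputable section
namespace SurfaceBraid

open Quaternion Metric Set

/-! ### Surjectivity of the covering by frames -/

/-- The scalar product of the imaginary parts of two quaternions. -/
def imDot (v w : ℍ[ℝ]) : ℝ := v.imI * w.imI + v.imJ * w.imJ + v.imK * w.imK

theorem mul_self_of_imaginary {v : ℍ[ℝ]} (hv : v.re = 0) (hn : normSq v = 1) : v * v = -1 := by
  rw [normSq_def', hv] at hn
  ext
  · simp [hv]; linarith
  · simp [hv]; ring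
  · simp [hv]; ring
  · simp [hv]; ring

theorem mul_comm_of_orthogonal {v w : ℍ[ℝ]} (hv : v.re = 0) (hw : w.re = 0)
    (h : imDot v w = 0) : w * v = -(v * w) := by
  unfold imDot at h
  ext
  · simp [hv, hw]; linarith
  · simp [hv, hw]; ring
  · simp [hv, hw]; ring
  · simp [hv, hw]; ring

/-- Every orthonormal pair of imaginary quaternions is the image of the pair `i`, `j` under the
rotation by a unit quaternion. The quaternion is a normalized nonzero value of the averaging
operator `x ↦ x - v x i - w x j - v w x k`, whose values intertwine the two pairs, and which is not
zero because its trace is `4`. -/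
theorem exists_rotation {v w : ℍ[ℝ]} (hv : v.re = 0) (hw : w.re = 0) (hvn : normSq v = 1)
    (hwn : normSq w = 1) (h : imDot v w = 0) :
    ∃ q : S3, q * quat 0 1 0 0 * star (q : ℍ[ℝ]) = v ∧ q * quat 0 0 1 0 * star (q : ℍ[ℝ]) = w := by
  have hvv := mul_self_of_imaginary hv hvn
  have hww := mul_self_of_imaginary hw hwn
  have hwv := mul_comm_of_orthogonal hv hw h
  have e1 : ∀ x, v * (v * x) = -x := fun x => by rw [← mul_assoc, hvv, neg_one_mul]
  have e2 : ∀ x, w * (w * x) = -x := fun x => by rw [← mul_assoc, hww, neg_one_mul]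
  have e3 : ∀ x, w * (v * x) = -(v * (w * x)) := fun x => by
    rw [← mul_assoc, hwv, neg_mul, mul_assoc]
  set i : ℍ[ℝ] := quat 0 1 0 0 with hi
  set j : ℍ[ℝ] := quat 0 0 1 0 with hj
  set k : ℍ[ℝ] := quat 0 0 0 1 with hk
  have ii : i * i = -1 := by ext <;> simp [hi]
  have jj : j * j = -1 := by ext <;> simp [hj]
  have ij : i * j = k := by ext <;> simp [hi, hj, hk]
  have ji : j * i = -k := by ext <;> simp [hi, hj, hk]
  have ki : k * i = j := by ext <;> simp [hi, hj, hk]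
  have kj : k * j = -i := by ext <;> simp [hi, hj, hk]
  let T : ℍ[ℝ] → ℍ[ℝ] := fun x => x - v * (x * i) - w * (x * j) - v * (w * (x * k))
  have hTi : ∀ x, v * T x = T x * i := fun x => by
    simp only [T, mul_sub, sub_mul, mul_assoc, e1, ii, ji, ki, mul_neg, mul_one]
    abel
  have hTj : ∀ x, w * T x = T x * j := fun x => by
    simp only [T, mul_sub, sub_mul, mul_assoc, e2, e3, jj, ij, kj, mul_neg, neg_neg, mul_one]
    abel
  obtain ⟨x, hx⟩ : ∃ x, T x ≠ 0 := by
    by_contra! hT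
    have h1 := congrArg QuaternionAlgebra.re (hT 1)
    have h2 := congrArg QuaternionAlgebra.imI (hT i)
    have h3 := congrArg QuaternionAlgebra.imJ (hT j)
    have h4 := congrArg QuaternionAlgebra.imK (hT k)
    simp [T, hi, hj, hk, hv, hw] at h1 h2 h3 h4
    linarith
  have hx0 : ‖T x‖ ≠ 0 := norm_ne_zero_iff.2 hx
  let q : S3 := ⟨‖T x‖⁻¹ • T x, by
    rw [mem_sphere_zero_iff_norm, norm_smul, norm_inv, norm_norm, inv_mul_cancel₀ hx0]⟩
  have hq : ∀ a b : ℍ[ℝ], b * T x = T x * a → q * a * star (q : ℍ[ℝ]) = b := by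
    intro a b hab
    have h1 : (q : ℍ[ℝ]) * a = b * q := by
      change (‖T x‖⁻¹ • T x) * a = b * (‖T x‖⁻¹ • T x)
      rw [smul_mul_assoc, mul_smul_comm, hab]
    rw [h1, mul_assoc, self_mul_star_S3, mul_one]
  exact ⟨q, hq _ _ (hTi x), hq _ _ (hTj x)⟩

/-- Every line in `ℝ³` is spanned by an imaginary quaternion of norm `1`. -/
theorem exists_unit_imaginary (p : RP2) :
    ∃ (v : ℍ[ℝ]) (_ : v.re = 0) (_ : normSq v = 1) (h : imVec v ≠ 0),
      p = Projectivization.mk ℝ (imVec v) h := by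
  induction p using Projectivization.ind with | h w hw => ?_
  have hpos : 0 < ∑ k, w k ^ 2 := lt_of_le_of_ne
    (Finset.sum_nonneg fun k _ => sq_nonneg _) (sum_sq_ne_zero hw).symm
  set r : ℝ := (√(∑ k, w k ^ 2))⁻¹ with hr
  have hr0 : r ≠ 0 := inv_ne_zero (Real.sqrt_pos.2 hpos).ne'
  have hr2 : r ^ 2 * ∑ k, w k ^ 2 = 1 := by
    rw [hr, inv_pow, Real.sq_sqrt hpos.le, inv_mul_cancel₀ hpos.ne']
  have him : imVec (quat 0 (r * w 0) (r * w 1) (r * w 2)) = r • w := by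
    ext k
    fin_cases k <;> simp [imVec]
  have hne : imVec (quat 0 (r * w 0) (r * w 1) (r * w 2)) ≠ 0 := by
    rw [him]
    exact smul_ne_zero hr0 hw
  refine ⟨quat 0 (r * w 0) (r * w 1) (r * w 2), rfl, ?_, hne,
    (Projectivization.mk_eq_mk_iff' ℝ _ _ _ _).2 ⟨r⁻¹, ?_⟩⟩
  · rw [Fin.sum_univ_three] at hr2
    rw [normSq_def']
    simp only [quat_re, quat_imI, quat_imJ, quat_imK]
    linarith
  · rw [him, inv_smul_smul₀ hr0]

theorem normSq_lin_comb {v w : ℍ[ℝ]} (hv : v.re = 0) (hw : w.re = 0) (hvn : normSq v = 1)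
    (hwn : normSq w = 1) (a b : ℝ) :
    normSq (a • v + b • w) = a ^ 2 + b ^ 2 + 2 * a * b * imDot v w := by
  rw [normSq_def', hv] at hvn
  rw [normSq_def', hw] at hwn
  rw [normSq_def', imDot]
  simp [hv, hw]
  linear_combination a ^ 2 * hvn + b ^ 2 * hwn

theorem imDot_lin_comb {v w : ℍ[ℝ]} (hv : v.re = 0) (hw : w.re = 0) (hvn : normSq v = 1)
    (hwn : normSq w = 1) (a b c d : ℝ) :
    imDot (a • v + b • w) (c • v + d • w) = a * c + b * d + (a * d + b * c) * imDot v w := by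
  rw [normSq_def', hv] at hvn
  rw [normSq_def', hw] at hwn
  simp [imDot]
  linear_combination a * c * hvn + b * d * hwn

/-- Two distinct lines are obtained from a frame: its axes `i + j` and `i - j` are rotated to the
two bisectors of the lines, and the parameter is determined by the angle. -/
theorem surjective_frameConf : Function.Surjective frameConf := by
  intro x
  obtain ⟨v, hv, hvn, hv0, hxv⟩ := exists_unit_imaginary (x.1 0)
  obtain ⟨w, hw, hwn, hw0, hxw⟩ := exists_unit_imaginary (x.1 1)
  set c := imDot v w with hc
  have hne : ∀ r : ℝ, v ≠ r • w := fun r h => by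
    have h1 : x.1 0 = x.1 1 := by
      rw [hxv, hxw, rp2_mk_imVec_eq_iff hv hw]
      exact ⟨r, h⟩
    exact zero_ne_one (x.2 h1)
  have hc1 : c < 1 := by
    have h1 := normSq_lin_comb hv hw hvn hwn 1 (-1)
    have h2 : (1 : ℝ) • v + (-1 : ℝ) • w ≠ 0 := fun h => hne 1 (by
      rw [one_smul, neg_smul, add_neg_eq_zero] at h
      exact h)
    have h3 := lt_of_le_of_ne normSq_nonneg (normSq_ne_zero.2 h2).symm
    rw [h1] at h3
    linarith
  have hc2 : -1 < c := by
    have h1 := normSq_lin_comb hv hw hvn hwn 1 1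
    have h2 : (1 : ℝ) • v + (1 : ℝ) • w ≠ 0 := fun h => hne (-1) (by
      rw [one_smul, add_eq_zero_iff_eq_neg, ← neg_smul] at h
      exact h)
    have h3 := lt_of_le_of_ne normSq_nonneg (normSq_ne_zero.2 h2).symm
    rw [h1] at h3
    linarith
  -- `2 p (v + w)` and `2 s (v - w)` have norm `√2`, like the axes `i + j` and `i - j`
  obtain ⟨p, hp0, hp⟩ : ∃ p : ℝ, 0 < p ∧ 4 * p ^ 2 * (1 + c) = 1 := by
    have h1 : 0 < 1 + c := by linarith
    refine ⟨(2 * √(1 + c))⁻¹, by positivity, ?_⟩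
    rw [inv_pow, mul_pow, Real.sq_sqrt h1.le]
    field_simp
    norm_num
  obtain ⟨s, hs0, hs⟩ : ∃ s : ℝ, 0 < s ∧ 4 * s ^ 2 * (1 - c) = 1 := by
    have h1 : 0 < 1 - c := by linarith
    refine ⟨(2 * √(1 - c))⁻¹, by positivity, ?_⟩
    rw [inv_pow, mul_pow, Real.sq_sqrt h1.le]
    field_simp
    norm_num
  obtain ⟨q, hq1, hq2⟩ := exists_rotation (v := (p + s) • v + (p - s) • w)
    (w := (p - s) • v + (p + s) • w) (by simp [hv, hw]) (by simp [hv, hw])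
    (by rw [normSq_lin_comb hv hw hvn hwn]; linarith)
    (by rw [normSq_lin_comb hv hw hvn hwn]; linarith)
    (by rw [imDot_lin_comb hv hw hvn hwn]; linarith)
  have hps : 0 < s + p := by linarith
  set t : ℝ := (s - p) / (s + p) with ht
  have ht' : t * (s + p) = s - p := div_mul_cancel₀ _ hps.ne'
  have htm : t ∈ Ioo (-1 : ℝ) 1 := by
    constructor
    · rw [ht, lt_div_iff₀ hps]; linarith
    · rw [ht, div_lt_one hps]; linarith
  have hd0 : dir 0 q t = ((p + s) + t * (p - s)) • v := by
    have h1 : stdDir 0 t = quat 0 1 0 0 + t • quat 0 0 1 0 := by ext <;> simp [stdDir]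
    rw [dir, h1, mul_add, add_mul, mul_smul_comm, smul_mul_assoc, hq1, hq2]
    have h2 : (p - s) + t * (p + s) = 0 := by linarith
    linear_combination (norm := module) h2 • w
  have hd1 : dir 1 q t = ((p + s) + t * (p - s)) • w := by
    have h1 : stdDir 1 t = quat 0 0 1 0 + t • quat 0 1 0 0 := by ext <;> simp [stdDir]
    rw [dir, h1, mul_add, add_mul, mul_smul_comm, smul_mul_assoc, hq1, hq2]
    have h2 : (p - s) + t * (p + s) = 0 := by linarith
    linear_combination (norm := module) h2 • v
  refine ⟨(q, ⟨t, htm⟩), conf_two_ext ?_ ?_⟩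
  · rw [hxv]
    exact (rp2_mk_imVec_eq_iff (dir_re ..) hv _ _).2 ⟨_, hd0⟩
  · rw [hxw]
    exact (rp2_mk_imVec_eq_iff (dir_re ..) hw _ _).2 ⟨_, hd1⟩

/-! ### The universal covering of the unordered configuration space -/

/-- The covering by frames is the restriction to `F(ℝP², 2)` of a continuous map from a compact
space to `ℝP² × ℝP²`, hence it is closed. -/
theorem isQuotientMap_frameConf : Topology.IsQuotientMap frameConf := by
  let F : S3 × Icc (-1 : ℝ) 1 → Fin 2 → RP2 := fun x => lines (x.1, x.2)
  have hF : Continuous F := continuous_lines.comp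
    (continuous_fst.prodMk (continuous_subtype_val.comp continuous_snd))
  let s : Set (Fin 2 → RP2) := {x | Function.Injective x}
  have hmem : ∀ x : F ⁻¹' s, (x.1.2 : ℝ) ∈ Ioo (-1 : ℝ) 1 := fun x =>
    (injective_lines_iff x.1.2.2).1 x.2
  let g : F ⁻¹' s → FrameCover := fun x => (x.1.1, ⟨x.1.2, hmem x⟩)
  have hg : Continuous g := (continuous_fst.comp continuous_subtype_val).prodMk
    (Continuous.subtype_mk (continuous_subtype_val.comp
      (continuous_snd.comp continuous_subtype_val)) _)
  have hclosed : IsClosedMap (s.restrictPreimage F) := hF.isClosedMap.restrictPreimage s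
  have hsurj : Function.Surjective (s.restrictPreimage F) := fun y => by
    obtain ⟨x, hx⟩ := surjective_frameConf y
    refine ⟨⟨(x.1, ⟨x.2, Ioo_subset_Icc_self x.2.2⟩), ?_⟩, ?_⟩
    · exact (frameConf x).2
    · exact hx
  have hq : Topology.IsQuotientMap (s.restrictPreimage F) :=
    hclosed.isQuotientMap (hF.restrictPreimage) hsurj
  exact Topology.IsQuotientMap.of_comp hg frameConf.continuous hq

theorem exists_eq_pow_mul_pow (g : QuaternionGroup 4) :
    ∃ (m : Fin 8) (n : Fin 2), g = .a 1 ^ (m : ℕ) * .xa 0 ^ (n : ℕ) := by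
  revert g
  decide

/-- The frames form a covering of the unordered configuration space `F(ℝP², 2) / Σ₂`, with the
generalized quaternion group of order `16` as group. -/
theorem isQuotientCoveringMap_frame :
    IsQuotientCoveringMap (proj RP2 2 ∘ frameConf) (QuaternionGroup 4) := by
  have hcont : ContinuousConstSMul (QuaternionGroup 4) FrameCover := ⟨fun g => by
    refine Continuous.prodMk ?_ (Continuous.subtype_mk ?_ _)
    · exact continuous_fst.mul continuous_const
    · exact continuous_const.mul (continuous_subtype_val.comp continuous_snd)⟩
  have hcancel : IsCancelSMul (QuaternionGroup 4) FrameCover := ⟨fun g h x hx => by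
    have h1 : x.1 * (psi g)⁻¹ = x.1 * (psi h)⁻¹ := congrArg Prod.fst hx
    exact psi_injective (inv_injective (mul_left_cancel h1))⟩
  have hloc : LocallyCompactSpace (Ioo (-1 : ℝ) 1) := isOpen_Ioo.locallyCompactSpace
  have hq : Topology.IsQuotientMap (proj RP2 2 ∘ frameConf) :=
    (isQuotientCoveringMap_proj RP2 2).toIsQuotientMap.comp isQuotientMap_frameConf
  refine hq.isQuotientCoveringMap_of_properlyDiscontinuousSMul fun {x y} => ?_
  constructor
  · intro h
    obtain ⟨τ, hτ⟩ := proj_eq_iff.1 h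
    have key : ∀ τ : Equiv.Perm (Fin 2), τ = 1 ∨ τ = Equiv.swap 0 1 := by decide
    rcases key τ with rfl | rfl
    · exact exists_smul_eq_of_frameConf_eq (by rw [← hτ]; exact one_smul _ _)
    · obtain ⟨g, hg⟩ := exists_smul_eq_of_frameConf_eq
        (x := x) (y := (QuaternionGroup.a 1 : QuaternionGroup 4) • y)
        (by rw [← hτ, frameConf_a_one_smul])
      exact ⟨g * .a 1, by rw [← hg]; exact mul_smul ..⟩
  · rintro ⟨g, rfl⟩
    obtain ⟨m, n, rfl⟩ := exists_eq_pow_mul_pow g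
    refine proj_eq_iff.2 ⟨(Equiv.swap 0 1) ^ (m : ℕ), ?_⟩
    change _ = frameConf (_ • y)
    rw [mul_smul, frameConf_a_one_pow_smul, frameConf_xa_zero_pow_smul]

end SurfaceBraid
end

noncomputable section

/-! ### The fundamental group of a quotient by a deck group -/

namespace IsQuotientCoveringMap

variable {E X G : Type*} [TopologicalSpace E] [TopologicalSpace X] [Group G] [MulAction G E]
  {p : E → X} (hp : IsQuotientCoveringMap p G)

/-- The isomorphism from the fundamental group of the base of a simply connected covering to the
deck group: a loop is sent to the inverse of the deck transformation that takes the base point `e`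
to the end of the lift of the loop which starts at `e`. -/
def deckEquiv [SimplyConnectedSpace E] {x : X} (e : p ⁻¹' {x}) : FundamentalGroup X x ≃* G :=
  (hp.fundamentalGroupEquiv e).trans (MulEquiv.inv' G).symm

theorem deckEquiv_eq_iff [SimplyConnectedSpace E] {x : X} {e : p ⁻¹' {x}}
    {γ : FundamentalGroup X x} {g : G} :
    hp.deckEquiv e γ = g ↔ (hp.isCoveringMap.monodromy γ e : E) = g⁻¹ • (e : E) := by
  rw [eq_comm (b := g⁻¹ • (e : E))]
  refine Iff.trans ?_ (hp.fundamentalGroupToMulOpposite_apply_eq_Iff (e := e) (γ := γ)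
    (g := MulOpposite.op g⁻¹))
  rw [deckEquiv, MulEquiv.trans_apply, MulEquiv.symm_apply_eq]
  rfl

theorem monodromy_eq_deckEquiv_inv_smul [SimplyConnectedSpace E] {x : X} (e : p ⁻¹' {x})
    (γ : FundamentalGroup X x) :
    (hp.isCoveringMap.monodromy γ e : E) = (hp.deckEquiv e γ)⁻¹ • (e : E) :=
  hp.deckEquiv_eq_iff.1 rfl

end IsQuotientCoveringMap

/-- For a covering with commutative group, the deck transformation determined by a loop does not
change when the loop is transported along a path. -/
theorem IsQuotientCoveringMap.monodromy_conj {E X G : Type*} [TopologicalSpace E]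
    [TopologicalSpace X] [CommGroup G] [MulAction G E] {p : E → X}
    (hp : IsQuotientCoveringMap p G) {x y : X} (c : Path.Homotopic.Quotient y x)
    (δ : Path.Homotopic.Quotient y y) (e : p ⁻¹' {x}) (z : p ⁻¹' {y}) {g : G}
    (hz : (hp.isCoveringMap.monodromy δ z : E) = g • (z : E)) :
    (hp.isCoveringMap.monodromy ((c.symm.trans δ).trans c) e : E) = g • (e : E) := by
  set z' := hp.isCoveringMap.monodromy c.symm e with hz'
  have hback : hp.isCoveringMap.monodromy c z' = e := by
    rw [hz', ← IsCoveringMap.monodromy_trans_apply]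
    have h1 : c.symm.trans c = .refl x := by
      induction c using Path.Homotopic.Quotient.ind with | mk c =>
      rw [← Path.Homotopic.Quotient.mk_symm, ← Path.Homotopic.Quotient.mk_trans]
      exact Path.Homotopic.Quotient.eq.2 ⟨(Path.Homotopy.reflSymmTrans c).symm⟩
    rw [h1, IsCoveringMap.monodromy_refl, id]
  obtain ⟨k, hk⟩ := hp.exists_toPermFiber_eq z z'
  have hδ : hp.isCoveringMap.monodromy δ z = hp.toPermFiber y g z := Subtype.ext hz
  have hδ' : hp.isCoveringMap.monodromy δ z' = hp.toPermFiber y g z' := by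
    rw [← hk, hp.monodromy_toPermFiber, hδ, ← Equiv.Perm.mul_apply, ← Equiv.Perm.mul_apply,
      ← map_mul, ← map_mul, mul_comm]
  rw [IsCoveringMap.monodromy_trans_apply, IsCoveringMap.monodromy_trans_apply, ← hz', hδ',
    hp.monodromy_toPermFiber, hback]
  rfl

namespace SurfaceBraid

open Quaternion Metric Set

/-! ### Removal of a strand from a pure braid -/

section RemoveStrand

variable {M : Type*} [TopologicalSpace M]

/-- The expression that defines `removeStrand`, evaluated on a lift whose end `q` is equal, but not
syntactically, to the base configuration. -/
theorem removeStrand_lift_eq (e : BaseArc M) {n : ℕ} (i : Fin (n + 1))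
    (γ : Path.Homotopic.Quotient (e.base (n + 1)) (e.base (n + 1)))
    (q : proj M (n + 1) ⁻¹' {proj M (n + 1) (e.base (n + 1))})
    (hq : q = ⟨e.base (n + 1), rfl⟩)
    (γ' : Path.Homotopic.Quotient (e.base (n + 1)) q.1) (hγ : γ' ≍ γ)
    (j : Fin (n + 1)) (hj : q.1.1 i = (e.base (n + 1)).1 j) :
    FundamentalGroup.fromPath
      ((((Path.Homotopic.Quotient.mk (e.shift i)).map (proj M n)).symm.trans
        (((γ'.map (forget i)).map (proj M n)).cast rfl (proj_forget_eq q.2 hj).symm)).trans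
      ((Path.Homotopic.Quotient.mk (e.shift j)).map (proj M n))) =
    FundamentalGroup.fromPath
      ((((Path.Homotopic.Quotient.mk (e.shift i)).map (proj M n)).symm.trans
        ((γ.map (forget i)).map (proj M n))).trans
      ((Path.Homotopic.Quotient.mk (e.shift i)).map (proj M n))) := by
  subst hq
  obtain rfl : i = j := (e.base (n + 1)).2 hj
  obtain rfl := eq_of_heq hγ
  rw [Path.Homotopic.Quotient.cast_rfl_rfl]

/-- On a pure braid, the removal of a strand is the map of fundamental groups induced by the
projection that forgets a point, followed by the transport along the shift of the base points. -/
theorem removeStrand_map [T2Space M] (e : BaseArc M) {n : ℕ} (i : Fin (n + 1))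
    (γ : FundamentalGroup (Conf M (n + 1)) (e.base (n + 1))) :
    removeStrand e i (FundamentalGroup.map (proj M (n + 1)) (e.base (n + 1)) γ) =
    FundamentalGroup.fromPath
      ((((Path.Homotopic.Quotient.mk (e.shift i)).map (proj M n)).symm.trans
        (((FundamentalGroup.toPath γ).map (forget i)).map (proj M n))).trans
      ((Path.Homotopic.Quotient.mk (e.shift i)).map (proj M n))) := by
  have cov := (isQuotientCoveringMap_proj M (n + 1)).isCoveringMap
  have hq : cov.monodromy (FundamentalGroup.toPath
      (FundamentalGroup.map (proj M (n + 1)) (e.base (n + 1)) γ)) ⟨e.base (n + 1), rfl⟩ =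
      ⟨e.base (n + 1), rfl⟩ := cov.monodromy_map (FundamentalGroup.toPath γ)
  refine removeStrand_lift_eq e i (FundamentalGroup.toPath γ) _ hq _ ?_ _
    (exists_end e i (cov.monodromy (FundamentalGroup.toPath
      (FundamentalGroup.map (proj M (n + 1)) (e.base (n + 1)) γ))
      ⟨e.base (n + 1), rfl⟩).2).choose_spec
  have h1 := cov.map_liftPathQuotient (FundamentalGroup.toPath
      (FundamentalGroup.map (proj M (n + 1)) (e.base (n + 1)) γ)) ⟨e.base (n + 1), rfl⟩
  have key : ∀ (q : Conf M (n + 1)) (h : q = e.base (n + 1))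
      (α : Path.Homotopic.Quotient (e.base (n + 1)) q),
      α.map (proj M (n + 1)) = ((FundamentalGroup.toPath γ).map (proj M (n + 1))).cast rfl
        (congrArg _ h) → α ≍ FundamentalGroup.toPath γ := by
    rintro q rfl α hα
    rw [Path.Homotopic.Quotient.cast_rfl_rfl] at hα
    exact heq_of_eq (cov.injective_path_homotopic_map _ _ hα)
  exact key _ (congrArg Subtype.val hq) _ h1

end RemoveStrand

/-! ### The covering of the projective plane by the sphere -/

/-- The unit sphere in `ℝ³`. -/
abbrev S2 : Type := sphere (0 : EuclideanSpace ℝ (Fin 3)) 1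

theorem ofLp_S2_ne_zero (v : S2) : WithLp.ofLp (v : EuclideanSpace ℝ (Fin 3)) ≠ 0 := fun h => by
  have h1 : (v : EuclideanSpace ℝ (Fin 3)) = 0 := by
    ext k
    exact congrFun h k
  have h2 := norm_eq_of_mem_sphere v
  rw [h1, norm_zero] at h2
  exact zero_ne_one h2

/-- The group `{±1}` acts on the sphere by the antipodal map. -/
instance instMulActionS2 : MulAction ℤˣ S2 where
  smul ε v := ⟨((ε : ℤ) : ℝ) • (v : EuclideanSpace ℝ (Fin 3)), by
    rcases Int.units_eq_one_or ε with rfl | rfl <;> simp⟩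
  one_smul v := Subtype.ext (by
    change (((1 : ℤˣ) : ℤ) : ℝ) • (v : EuclideanSpace ℝ (Fin 3)) = v
    simp)
  mul_smul a b v := Subtype.ext (by
    change (((a * b : ℤˣ) : ℤ) : ℝ) • (v : EuclideanSpace ℝ (Fin 3)) =
      ((a : ℤ) : ℝ) • ((b : ℤ) : ℝ) • (v : EuclideanSpace ℝ (Fin 3))
    simp [mul_smul])

theorem coe_smul_S2 (ε : ℤˣ) (v : S2) :
    ((ε • v : S2) : EuclideanSpace ℝ (Fin 3)) = ((ε : ℤ) : ℝ) • (v : EuclideanSpace ℝ (Fin 3)) :=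
  rfl

/-- The line through a point of the sphere, as a configuration of one point of `ℝP²`. -/
def sphereLine : C(S2, Conf RP2 1) where
  toFun v := ⟨fun _ => Projectivization.mk ℝ (WithLp.ofLp (v : EuclideanSpace ℝ (Fin 3)))
    (ofLp_S2_ne_zero v), Function.injective_of_subsingleton _⟩
  continuous_toFun := by
    refine Continuous.subtype_mk (continuous_pi fun _ => continuous_rp2_mk'.comp
      (Continuous.subtype_mk ?_ _)) _
    exact (PiLp.continuous_ofLp 2 _).comp continuous_subtype_val

theorem conf_one_ext {M : Type*} {x y : Conf M 1} (h : x.1 0 = y.1 0) : x = y := by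
  refine Subtype.ext (funext fun k => ?_)
  rw [Subsingleton.elim k 0]
  exact h

theorem sphereLine_eq_iff {v w : S2} : sphereLine v = sphereLine w ↔ ∃ ε : ℤˣ, ε • w = v := by
  constructor
  · intro h
    have h1 := congrFun (congrArg Subtype.val h) 0
    obtain ⟨r, hr⟩ := (Projectivization.mk_eq_mk_iff' ℝ _ _ _ _).1 h1
    have h2 : r • (w : EuclideanSpace ℝ (Fin 3)) = v := by
      ext k
      exact congrFun hr k
    have h3 : |r| = 1 := by
      have h4 := norm_eq_of_mem_sphere v
      rwa [← h2, norm_smul, norm_eq_of_mem_sphere, mul_one, Real.norm_eq_abs] at h4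
    rcases eq_or_eq_neg_of_abs_eq h3 with rfl | rfl
    · exact ⟨1, Subtype.ext (by rw [coe_smul_S2, ← h2]; simp)⟩
    · exact ⟨-1, Subtype.ext (by rw [coe_smul_S2, ← h2]; simp)⟩
  · rintro ⟨ε, rfl⟩
    refine conf_one_ext ((Projectivization.mk_eq_mk_iff' ℝ _ _ _ _).2 ⟨((ε : ℤ) : ℝ), ?_⟩)
    rfl

theorem surjective_sphereLine : Function.Surjective sphereLine := by
  intro x
  obtain ⟨v, hv, hvn, hv0, hxv⟩ := exists_unit_imaginary (x.1 0)
  refine ⟨⟨WithLp.toLp 2 (imVec v), ?_⟩, conf_one_ext hxv.symm⟩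
  rw [normSq_def', hv] at hvn
  rw [mem_sphere_zero_iff_norm, EuclideanSpace.norm_eq, Real.sqrt_eq_one, Fin.sum_univ_three]
  simp [imVec]
  linarith

/-- The sphere is a double covering of the configuration space of one point of `ℝP²`. -/
theorem isQuotientCoveringMap_sphere :
    IsQuotientCoveringMap (proj RP2 1 ∘ sphereLine) ℤˣ := by
  have hT2 : T2Space (Conf RP2 1) :=
    inferInstanceAs (T2Space {x : Fin 1 → RP2 // Function.Injective x})
  have hcont : ContinuousConstSMul ℤˣ S2 := ⟨fun ε =>
    Continuous.subtype_mk (continuous_subtype_val.const_smul ((ε : ℤ) : ℝ)) _⟩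
  have hcancel : IsCancelSMul ℤˣ S2 := ⟨fun a b v h => by
    have h1 : ((a : ℤ) : ℝ) • (v : EuclideanSpace ℝ (Fin 3)) =
      ((b : ℤ) : ℝ) • (v : EuclideanSpace ℝ (Fin 3)) := congrArg Subtype.val h
    have h2 := smul_left_injective ℝ (ne_zero_of_mem_unit_sphere v) h1
    exact Units.ext (Int.cast_injective h2)⟩
  have hq : Topology.IsQuotientMap (proj RP2 1 ∘ sphereLine) :=
    (isQuotientCoveringMap_proj RP2 1).toIsQuotientMap.comp
      (sphereLine.continuous.isClosedMap.isQuotientMap sphereLine.continuous surjective_sphereLine)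
  refine hq.isQuotientCoveringMap_of_properlyDiscontinuousSMul fun {v w} => ?_
  rw [Function.comp_apply, Function.comp_apply, proj_eq_iff]
  constructor
  · rintro ⟨τ, hτ⟩
    rw [Subsingleton.elim τ 1] at hτ
    exact sphereLine_eq_iff.1 ((one_smul _ _).symm.trans hτ).symm
  · intro h
    exact ⟨1, (one_smul _ _).trans (sphereLine_eq_iff.2 h).symm⟩

instance instSimplyConnectedSpaceS2 : SimplyConnectedSpace S2 :=
  simplyConnectedSpace_sphere (by simp)

theorem exists_sphereLine_base : ∃ v : S2, sphereLine v = rp2Arc.base 1 := surjective_sphereLine _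

/-- A point of the sphere over the base configuration of one point. -/
def sphereBase : (proj RP2 1 ∘ sphereLine) ⁻¹' {proj RP2 1 (rp2Arc.base 1)} :=
  ⟨exists_sphereLine_base.choose, congrArg (proj RP2 1) exists_sphereLine_base.choose_spec⟩

/-- The isomorphism of `B_1(ℝP²)` with `{±1}`, given by the ends of the lifts to the sphere. -/
def signEquiv : BraidGroup rp2Arc 1 ≃* ℤˣ := isQuotientCoveringMap_sphere.deckEquiv sphereBase

/-- The sign of a pure braid with one strand removed is read off from a lift to the sphere of the
motion of the remaining point, whatever the starting point of the lift. -/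
theorem signEquiv_removeStrand_map (i : Fin 2) (γ : FundamentalGroup (Conf RP2 2) (rp2Arc.base 2))
    (v : S2) (ε : ℤˣ) (Γ : Path.Homotopic.Quotient v (ε • v))
    (h0 : sphereLine v = forget i (rp2Arc.base 2))
    (h1 : sphereLine (ε • v) = forget i (rp2Arc.base 2))
    (h : Γ.map sphereLine = ((FundamentalGroup.toPath γ).map (forget i)).cast h0 h1) :
    signEquiv (removeStrand rp2Arc i
      (FundamentalGroup.map (proj RP2 2) (rp2Arc.base 2) γ)) = ε := by
  rw [removeStrand_map]
  refine isQuotientCoveringMap_sphere.deckEquiv_eq_iff.2 ?_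
  rw [Int.units_inv_eq_self]
  refine isQuotientCoveringMap_sphere.monodromy_conj _ _ _
    ⟨v, congrArg (proj RP2 1) h0⟩ ?_
  refine congrArg Subtype.val (isQuotientCoveringMap_sphere.isCoveringMap.monodromy_eq_of_map_eq
    (ey := ⟨ε • v, congrArg (proj RP2 1) h1⟩) Γ ?_)
  change Γ.map ((proj RP2 1).comp sphereLine) = _
  rw [Path.Homotopic.Quotient.map_comp, h, Path.Homotopic.Quotient.map_cast]

end SurfaceBraid
end

noncomputable section

namespace SurfaceBraid

open Quaternion Metric Set

/-! ### The deck transformations of pure braids -/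

/-- The embedding of the quaternion group of order `8` into that of order `16`. Its image consists
of the deck transformations that preserve the order of the two lines. -/
def quatHom : QuaternionGroup 2 →* QuaternionGroup 4 where
  toFun g := match g with
    | .a i => .a ((2 * i.val : ℕ) : ZMod (2 * 4))
    | .xa i => .xa ((2 * i.val : ℕ) : ZMod (2 * 4))
  map_one' := by decide
  map_mul' := by decide

theorem quatHom_injective : Function.Injective quatHom := by decide

instance decidableMemRangeQuatHom (g : QuaternionGroup 4) : Decidable (g ∈ quatHom.range) :=
  decidable_of_iff (∃ h, quatHom h = g) MonoidHom.mem_range.symm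

/-- The sign by which a deck transformation that preserves the order of the lines acts on the
direction of the `k`-th line. On the other deck transformations the value has no meaning. -/
def dirSign (k : Fin 2) (g : QuaternionGroup 4) : ℤˣ :=
  if g = .a 0 ∨ g = .a 4 ∨ g = .xa (2 * (k.val : ZMod (2 * 4))) ∨
    g = .xa (2 * (k.val : ZMod (2 * 4)) + 4) then 1 else -1

theorem dirSign_pow_mul_pow (k : Fin 2) (m : Fin 4) (n : Fin 2) :
    dirSign k (.a 2 ^ (m : ℕ) * .xa 0 ^ (n : ℕ)) = (-1) ^ (m : ℕ) * ((-1) ^ (k : ℕ)) ^ (n : ℕ) := by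
  revert k m n
  decide

theorem exists_eq_pow_mul_pow_of_mem_range {g : QuaternionGroup 4} (hg : g ∈ quatHom.range) :
    ∃ (m : Fin 4) (n : Fin 2), g = .a 2 ^ (m : ℕ) * .xa 0 ^ (n : ℕ) := by
  revert g
  decide

theorem dir_smul_a_two (k : Fin 2) (x : FrameCover) :
    dir k ((QuaternionGroup.a 2 : QuaternionGroup 4) • x).1
      ((QuaternionGroup.a 2 : QuaternionGroup 4) • x).2 = -dir k x.1 x.2 := by
  rw [show (QuaternionGroup.a 2 : QuaternionGroup 4) = .a 1 * .a 1 by decide, mul_smul]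
  fin_cases k
  · exact (dir_smul_a_one_zero _).trans (congrArg Neg.neg (dir_smul_a_one_one x))
  · exact (dir_smul_a_one_one _).trans (dir_smul_a_one_zero x)

theorem dir_smul_xa_zero (k : Fin 2) (x : FrameCover) :
    dir k ((QuaternionGroup.xa 0 : QuaternionGroup 4) • x).1
      ((QuaternionGroup.xa 0 : QuaternionGroup 4) • x).2 = (-1 : ℝ) ^ (k : ℕ) • dir k x.1 x.2 := by
  fin_cases k
  · simpa using dir_smul_xa_zero_zero x
  · simpa using dir_smul_xa_zero_one x

theorem dir_smul_of_mem_range {g : QuaternionGroup 4} (hg : g ∈ quatHom.range) (k : Fin 2)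
    (x : FrameCover) :
    dir k (g • x).1 (g • x).2 = ((dirSign k g : ℤ) : ℝ) • dir k x.1 x.2 := by
  have h1 : ∀ (m : ℕ) (x : FrameCover),
      dir k ((QuaternionGroup.a 2 : QuaternionGroup 4) ^ m • x).1
        ((QuaternionGroup.a 2 : QuaternionGroup 4) ^ m • x).2 = (-1 : ℝ) ^ m • dir k x.1 x.2 := by
    intro m x
    induction m with
    | zero => simp
    | succ m ih => rw [pow_succ', mul_smul, dir_smul_a_two, ih, pow_succ', mul_smul, neg_one_smul]
  have h2 : ∀ (m : ℕ) (x : FrameCover),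
      dir k ((QuaternionGroup.xa 0 : QuaternionGroup 4) ^ m • x).1
        ((QuaternionGroup.xa 0 : QuaternionGroup 4) ^ m • x).2 =
        ((-1 : ℝ) ^ (k : ℕ)) ^ m • dir k x.1 x.2 := by
    intro m x
    induction m with
    | zero => simp
    | succ m ih => rw [pow_succ', mul_smul, dir_smul_xa_zero, ih, pow_succ', mul_smul]
  obtain ⟨m, n, rfl⟩ := exists_eq_pow_mul_pow_of_mem_range hg
  rw [mul_smul, h1, h2, dirSign_pow_mul_pow, smul_smul]
  push_cast
  rfl

/-- A deck transformation preserves the order of the lines if and only if it lies in the quaternion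
group of order `8`. -/
theorem frameConf_smul_eq_iff (g : QuaternionGroup 4) (x : FrameCover) :
    frameConf (g • x) = frameConf x ↔ g ∈ quatHom.range := by
  constructor
  · intro h
    obtain ⟨m, n, rfl⟩ := exists_eq_pow_mul_pow g
    have key : ∀ (m : Fin 8) (n : Fin 2), (Equiv.swap 0 1 : Equiv.Perm (Fin 2)) ^ (m : ℕ) = 1 →
        (QuaternionGroup.a 1 : QuaternionGroup 4) ^ (m : ℕ) * .xa 0 ^ (n : ℕ) ∈ quatHom.range := by
      decide
    refine key m n (Equiv.ext fun k => ?_)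
    rw [mul_smul, frameConf_a_one_pow_smul, frameConf_xa_zero_pow_smul] at h
    have h2 := congrFun (congrArg Subtype.val h) ((Equiv.swap 0 1 ^ (m : ℕ)) k)
    rw [smul_conf_apply, ← Equiv.Perm.mul_apply, inv_mul_cancel] at h2
    exact ((frameConf x).2 h2).symm
  · intro hg
    refine Subtype.ext (funext fun k => ?_)
    rw [frameConf_apply, frameConf_apply, lines_eq_iff]
    exact ⟨_, dir_smul_of_mem_range hg k x⟩

theorem exists_frameConf_base : ∃ x : FrameCover, frameConf x = rp2Arc.base 2 :=
  surjective_frameConf _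

/-- A frame over the base configuration of two points. -/
def frameBase : (proj RP2 2 ∘ frameConf) ⁻¹' {proj RP2 2 (rp2Arc.base 2)} :=
  ⟨exists_frameConf_base.choose, congrArg (proj RP2 2) exists_frameConf_base.choose_spec⟩

theorem frameConf_frameBase : frameConf frameBase.1 = rp2Arc.base 2 :=
  exists_frameConf_base.choose_spec

/-- The isomorphism of `B_2(ℝP²)` with the generalized quaternion group of order `16`. -/
def deck : BraidGroup rp2Arc 2 ≃* QuaternionGroup 4 :=
  isQuotientCoveringMap_frame.deckEquiv frameBase

theorem proj_frameConf_frameBase :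
    proj RP2 2 (frameConf frameBase.1) = proj RP2 2 (rp2Arc.base 2) := frameBase.2

/-- Every braid lifts to a path of frames that starts at the base frame and ends at its image under
the inverse of the deck transformation of the braid. -/
theorem exists_lift_of_braid (β : BraidGroup rp2Arc 2) :
    ∃ (P : Path.Homotopic.Quotient frameBase.1 ((deck β)⁻¹ • frameBase.1))
      (h : proj RP2 2 (frameConf ((deck β)⁻¹ • frameBase.1)) = proj RP2 2 (rp2Arc.base 2)),
      (P.map frameConf).map (proj RP2 2) =
        (FundamentalGroup.toPath β).cast proj_frameConf_frameBase h := by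
  have cov := isQuotientCoveringMap_frame.isCoveringMap
  have h1 := cov.map_liftPathQuotient (FundamentalGroup.toPath β) frameBase
  have h2 := isQuotientCoveringMap_frame.monodromy_eq_deckEquiv_inv_smul frameBase β
  have key : ∀ y, (cov.monodromy (FundamentalGroup.toPath β) frameBase : FrameCover) = y →
      ∃ (P : Path.Homotopic.Quotient frameBase.1 y)
        (h : proj RP2 2 (frameConf y) = proj RP2 2 (rp2Arc.base 2)),
        (P.map frameConf).map (proj RP2 2) =
          (FundamentalGroup.toPath β).cast proj_frameConf_frameBase h := by
    rintro _ rfl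
    refine ⟨cov.liftPathQuotient (FundamentalGroup.toPath β) frameBase,
      (cov.monodromy (FundamentalGroup.toPath β) frameBase).2, Eq.trans ?_ h1⟩
    exact (Path.Homotopic.Quotient.map_comp (f := frameConf) (g := proj RP2 2)).symm
  exact key _ h2

/-- A braid is pure if and only if its deck transformation preserves the order of the lines. -/
theorem mem_pureBraidGroup_iff (β : BraidGroup rp2Arc 2) :
    β ∈ pureBraidGroup rp2Arc 2 ↔ deck β ∈ quatHom.range := by
  constructor
  · rintro ⟨γ, rfl⟩
    obtain ⟨P, h, hP⟩ := exists_lift_of_braid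
      (FundamentalGroup.map (proj RP2 2) (rp2Arc.base 2) γ)
    have cov := (isQuotientCoveringMap_proj RP2 2).isCoveringMap
    have h1 := cov.monodromy_map (FundamentalGroup.toPath γ)
    have h2 := cov.monodromy_eq_of_map_eq (ex := ⟨_, proj_frameConf_frameBase⟩) (ey := ⟨_, h⟩)
      (P.map frameConf) hP
    have h3 : (⟨frameConf frameBase.1, proj_frameConf_frameBase⟩ :
        proj RP2 2 ⁻¹' {proj RP2 2 (rp2Arc.base 2)}) = ⟨rp2Arc.base 2, rfl⟩ :=
      Subtype.ext frameConf_frameBase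
    rw [h3] at h2
    rw [← inv_mem_iff, ← frameConf_smul_eq_iff _ frameBase.1, frameConf_frameBase]
    exact (congrArg Subtype.val (h1.symm.trans h2)).symm
  · intro hg
    obtain ⟨P, h, hP⟩ := exists_lift_of_braid β
    have h1 : frameConf ((deck β)⁻¹ • frameBase.1) = rp2Arc.base 2 := by
      rw [(frameConf_smul_eq_iff _ _).2 (inv_mem hg), frameConf_frameBase]
    refine ⟨(P.map frameConf).cast frameConf_frameBase.symm h1.symm, ?_⟩
    change ((P.map frameConf).cast _ _).map (proj RP2 2) = β
    rw [Path.Homotopic.Quotient.map_cast, hP, Path.Homotopic.Quotient.cast_cast]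
    exact Path.Homotopic.Quotient.cast_rfl_rfl _

/-! ### Signs of pure braids with one strand removed -/

/-- The direction of the `k`-th line of a frame, as a vector of the Euclidean space. -/
def dirVec (k : Fin 2) (x : FrameCover) : EuclideanSpace ℝ (Fin 3) :=
  WithLp.toLp 2 (imVec (dir k x.1 x.2))

theorem norm_dirVec_ne_zero (k : Fin 2) (x : FrameCover) : ‖dirVec k x‖ ≠ 0 :=
  norm_ne_zero_iff.2 fun h => imVec_dir_ne_zero k x.1 x.2 (congrArg WithLp.ofLp h)

theorem continuous_dirVec (k : Fin 2) : Continuous (dirVec k) := by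
  let f : S3 × ℝ → EuclideanSpace ℝ (Fin 3) := fun x => WithLp.toLp 2 (imVec (dir k x.1 x.2))
  have hf : Continuous f :=
    (PiLp.continuous_toLp 2 fun _ : Fin 3 => ℝ).comp (continuous_imVec.comp (continuous_dir k))
  let g : FrameCover → S3 × ℝ := fun x => (x.1, x.2)
  have hg : Continuous g := continuous_fst.prodMk (continuous_subtype_val.comp continuous_snd)
  have h : dirVec k = f ∘ g := rfl
  rw [h]
  exact hf.comp hg

/-- The direction of the `k`-th line of a frame, as a point of the sphere. -/
def dirSphere (k : Fin 2) : C(FrameCover, S2) where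
  toFun x := ⟨‖dirVec k x‖⁻¹ • dirVec k x, by
    rw [mem_sphere_zero_iff_norm, norm_smul, norm_inv, norm_norm,
      inv_mul_cancel₀ (norm_dirVec_ne_zero k x)]⟩
  continuous_toFun := Continuous.subtype_mk
    (((continuous_dirVec k).norm.inv₀ (norm_dirVec_ne_zero k)).smul (continuous_dirVec k)) _

theorem dirSphere_smul {g : QuaternionGroup 4} (hg : g ∈ quatHom.range) (k : Fin 2)
    (x : FrameCover) : dirSphere k (g • x) = dirSign k g • dirSphere k x := by
  have h : dirVec k (g • x) = ((dirSign k g : ℤ) : ℝ) • dirVec k x := by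
    rw [dirVec, dir_smul_of_mem_range hg, map_smul, WithLp.toLp_smul, dirVec]
  refine Subtype.ext ?_
  change ‖dirVec k (g • x)‖⁻¹ • dirVec k (g • x) =
    ((dirSign k g : ℤ) : ℝ) • (‖dirVec k x‖⁻¹ • dirVec k x)
  rw [h, norm_smul]
  rcases Int.units_eq_one_or (dirSign k g) with h | h <;> simp [h]

theorem sphereLine_comp_dirSphere (i : Fin 2) :
    sphereLine.comp (dirSphere (i.succAbove 0)) = (forget i).comp frameConf := by
  refine ContinuousMap.ext fun x => conf_one_ext ?_
  exact (Projectivization.mk_eq_mk_iff' ℝ _ _ _ _).2 ⟨‖dirVec (i.succAbove 0) x‖⁻¹, rfl⟩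

theorem quotient_map_congr {X Y : Type*} [TopologicalSpace X] [TopologicalSpace Y] {x y : X}
    (P : Path.Homotopic.Quotient x y) {f g : C(X, Y)} (h : f = g) :
    P.map f = (P.map g).cast (by rw [h]) (by rw [h]) := by
  subst h
  exact (Path.Homotopic.Quotient.cast_rfl_rfl _).symm

/-- If a pure braid lifts to a path of frames, the direction of the line that is not removed moves
along a lift to the sphere of the remaining strand. -/
theorem signEquiv_removeStrand_of_lift (i : Fin 2)
    (γ : FundamentalGroup (Conf RP2 2) (rp2Arc.base 2)) {x y : FrameCover}
    (P : Path.Homotopic.Quotient x y) (hx : frameConf x = rp2Arc.base 2)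
    (hy : frameConf y = rp2Arc.base 2) (hP : P.map frameConf = (FundamentalGroup.toPath γ).cast hx hy)
    {ε : ℤˣ} (hε : dirSphere (i.succAbove 0) y = ε • dirSphere (i.succAbove 0) x) :
    signEquiv (removeStrand rp2Arc i
      (FundamentalGroup.map (proj RP2 2) (rp2Arc.base 2) γ)) = ε := by
  have hf : ∀ z, sphereLine (dirSphere (i.succAbove 0) z) = forget i (frameConf z) := fun z =>
    DFunLike.congr_fun (sphereLine_comp_dirSphere i) z
  refine signEquiv_removeStrand_map i γ (dirSphere (i.succAbove 0) x) ε
    ((P.map (dirSphere (i.succAbove 0))).cast rfl hε.symm)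
    ((hf x).trans (congrArg _ hx)) (by rw [← hε, hf, hy]) ?_
  rw [Path.Homotopic.Quotient.map_cast, ← Path.Homotopic.Quotient.map_comp,
    quotient_map_congr P (sphereLine_comp_dirSphere i), Path.Homotopic.Quotient.map_comp, hP,
    Path.Homotopic.Quotient.map_cast, Path.Homotopic.Quotient.cast_cast,
    Path.Homotopic.Quotient.cast_cast]

/-- Removing the `i`-th strand of a pure braid leaves the sign by which its deck transformation
acts on the direction of the other line. -/
theorem signEquiv_removeStrand {β : BraidGroup rp2Arc 2} (hβ : β ∈ pureBraidGroup rp2Arc 2)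
    (i : Fin 2) :
    signEquiv (removeStrand rp2Arc i β) = dirSign (i.succAbove 0) (deck β) := by
  have hg := (mem_pureBraidGroup_iff β).1 hβ
  obtain ⟨γ, rfl⟩ := hβ
  obtain ⟨P, h, hP⟩ := exists_lift_of_braid (FundamentalGroup.map (proj RP2 2) (rp2Arc.base 2) γ)
  have h1 := ((frameConf_smul_eq_iff _ frameBase.1).2 (inv_mem hg)).trans frameConf_frameBase
  -- the lift ends at the image under the inverse, which has the same signs
  have hinv : ∀ (k : Fin 2) (g : QuaternionGroup 4), g ∈ quatHom.range →
      dirSign k g⁻¹ = dirSign k g := by decide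
  rw [← hinv _ _ hg]
  refine signEquiv_removeStrand_of_lift i γ P frameConf_frameBase h1 ?_
    (dirSphere_smul (inv_mem hg) _ _)
  refine (isQuotientCoveringMap_proj RP2 2).isCoveringMap.injective_path_homotopic_map _ _ ?_
  refine hP.trans ?_
  exact (Path.Homotopic.Quotient.map_cast (f := proj RP2 2) (FundamentalGroup.toPath γ)).symm

end SurfaceBraid
end

noncomputable section

namespace SurfaceBraid

open Quaternion Metric Set

/-! ### The generators -/

theorem rho_eq_map : rho = FundamentalGroup.map (proj RP2 2) (rp2Arc.base 2)
    (FundamentalGroup.fromPath (.mk rhoPath)) := by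
  rw [rho, BraidGroup.ofPath, Path.Homotopic.Quotient.cast_rfl_rfl]
  rfl

theorem rho_mem_pureBraidGroup : rho ∈ pureBraidGroup rp2Arc 2 := ⟨_, rho_eq_map.symm⟩

/-- If a path on the sphere from a point to its image under a sign covers the motion of the
remaining point of `ρ`, then this sign is the value of `ρ` with one strand removed. -/
theorem signEquiv_removeStrand_rho (i : Fin 2) {v w : S2} (ε : ℤˣ) (hw : w = ε • v) (c : Path v w)
    (hc : ∀ t, (sphereLine (c t)).1 0 = (rhoPath t).1 (i.succAbove 0)) :
    signEquiv (removeStrand rp2Arc i rho) = ε := by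
  subst hw
  have h : ∀ t, sphereLine (c t) = forget i (rhoPath t) := fun t => conf_one_ext (hc t)
  have h0 : sphereLine v = forget i (rp2Arc.base 2) := by simpa using h 0
  have h1 : sphereLine (ε • v) = forget i (rp2Arc.base 2) := by simpa using h 1
  rw [rho_eq_map]
  refine signEquiv_removeStrand_map i _ v ε (.mk c) h0 h1 ?_
  change Path.Homotopic.Quotient.mk (c.map sphereLine.continuous) =
    Path.Homotopic.Quotient.mk ((rhoPath.map (forget i).continuous).cast h0 h1)
  exact congrArg _ (Path.ext (funext h))

/-- Without its first strand, `ρ` is the constant braid. -/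
theorem signEquiv_removeStrand_zero_rho : signEquiv (removeStrand rp2Arc 0 rho) = 1 := by
  obtain ⟨v, hv⟩ := surjective_sphereLine (forget 0 (rp2Arc.base 2))
  refine signEquiv_removeStrand_rho 0 1 (one_smul _ v).symm (Path.refl v) fun t => ?_
  have h : (sphereLine v).1 0 = (forget 0 (rp2Arc.base 2)).1 0 := by rw [hv]
  exact h.trans (congrArg (fun a => affinePoint a 0) Nat.cast_one)

/-- The arc of a great circle that covers the motion of the first point of `ρ`. -/
def greatArc (t : ℝ) : S2 :=
  ⟨!₂[Real.cos (Real.pi * t), 0, Real.sin (Real.pi * t)], by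
    rw [mem_sphere_zero_iff_norm, EuclideanSpace.norm_eq, Real.sqrt_eq_one, Fin.sum_univ_three]
    simp⟩

theorem continuous_greatArc : Continuous greatArc := by
  refine Continuous.subtype_mk ((PiLp.continuous_toLp 2 fun _ : Fin 3 => ℝ).comp ?_) _
  refine continuous_pi fun k => ?_
  fin_cases k
  · change Continuous fun t : ℝ => Real.cos (Real.pi * t)
    fun_prop
  · exact continuous_const
  · change Continuous fun t : ℝ => Real.sin (Real.pi * t)
    fun_prop

theorem greatArc_one : greatArc 1 = (-1 : ℤˣ) • greatArc 0 := by
  refine Subtype.ext ?_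
  rw [coe_smul_S2]
  ext k
  fin_cases k <;> simp [greatArc]

/-- Without its second strand, `ρ` runs along half a great circle. -/
theorem signEquiv_removeStrand_one_rho : signEquiv (removeStrand rp2Arc 1 rho) = -1 :=
  signEquiv_removeStrand_rho 1 (-1) greatArc_one
    { toFun := fun t => greatArc t
      continuous_toFun := continuous_greatArc.comp continuous_subtype_val
      source' := rfl
      target' := rfl } fun _ => rfl

/-- The half twist exchanges the two points, so it is not pure. -/
theorem sigma_notMem_pureBraidGroup : sigma ∉ pureBraidGroup rp2Arc 2 := by
  rintro ⟨γ, hγ⟩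
  have cov := (isQuotientCoveringMap_proj RP2 2).isCoveringMap
  have hs : proj RP2 2 ((Equiv.swap 0 1 : Equiv.Perm (Fin 2)) • rp2Arc.base 2) =
      proj RP2 2 (rp2Arc.base 2) := proj_eq_iff.2 ⟨_, rfl⟩
  have h1 := cov.monodromy_map (FundamentalGroup.toPath γ)
  have h2 : cov.monodromy (FundamentalGroup.toPath sigma) ⟨rp2Arc.base 2, rfl⟩ = ⟨_, hs⟩ :=
    cov.monodromy_eq_of_map_eq (ex := ⟨rp2Arc.base 2, rfl⟩) (ey := ⟨_, hs⟩) (.mk sigmaPath)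
      (by
        exact ((Path.Homotopic.Quotient.cast_cast _ _ _ _ _).trans
          (Path.Homotopic.Quotient.cast_rfl_rfl _)).symm)
  rw [← hγ] at h2
  have h3 := congrFun (congrArg Subtype.val (congrArg Subtype.val (h1.symm.trans h2))) 0
  have h4 := (rp2Arc.base 2).2 h3
  exact absurd h4 (by decide)

/-- The braid `ρ` is determined, up to the central involution, by its signs. -/
theorem deck_rho : deck rho = .xa 2 ∨ deck rho = .xa 6 := by
  have h := (mem_pureBraidGroup_iff rho).1 rho_mem_pureBraidGroup
  have h0 := (signEquiv_removeStrand rho_mem_pureBraidGroup 0).symm.trans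
    signEquiv_removeStrand_zero_rho
  have h1 := (signEquiv_removeStrand rho_mem_pureBraidGroup 1).symm.trans
    signEquiv_removeStrand_one_rho
  generalize deck rho = g at h h0 h1
  revert g
  decide

/-- Conjugation by any element outside the quaternion group of order `8` moves `xa 2` and `xa 6` to
`xa 0` and `xa 4`, so it is enough to know that `σ₁` is not pure. -/
theorem deck_u : deck u = .xa 0 ∨ deck u = .xa 4 := by
  have key : ∀ r s : QuaternionGroup 4, r = .xa 2 ∨ r = .xa 6 → s ∉ quatHom.range →
      s * r * s⁻¹ = .xa 0 ∨ s * r * s⁻¹ = .xa 4 := by decide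
  rw [u, map_mul, map_mul, map_inv]
  exact key _ _ deck_rho fun h => sigma_notMem_pureBraidGroup ((mem_pureBraidGroup_iff sigma).2 h)

/-! ### Pure braids, Cohen braids and Brunnian braids -/

theorem pureBraidGroup_eq_comap : pureBraidGroup rp2Arc 2 = quatHom.range.comap deck.toMonoidHom :=
  Subgroup.ext fun β => mem_pureBraidGroup_iff β

/-- The pure braid group `P_2(ℝP²)` is the quaternion group of order `8`. -/
def pureBraidGroupEquiv : pureBraidGroup rp2Arc 2 ≃* QuaternionGroup 2 :=
  (deck.subgroupMap (pureBraidGroup rp2Arc 2)).trans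
    ((MulEquiv.subgroupCongr (by
      rw [pureBraidGroup_eq_comap]
      exact Subgroup.map_comap_eq_self_of_surjective deck.surjective _)).trans
      (MonoidHom.ofInjective quatHom_injective).symm)

theorem u_mem_pureBraidGroup : u ∈ pureBraidGroup rp2Arc 2 := by
  rw [mem_pureBraidGroup_iff]
  rcases deck_u with h | h <;> rw [h] <;> decide

theorem closure_u_rho : Subgroup.closure {u, rho} = pureBraidGroup rp2Arc 2 := by
  refine le_antisymm ((Subgroup.closure_le _).2 ?_) fun β hβ => ?_
  · rintro _ (rfl | rfl)
    · exact u_mem_pureBraidGroup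
    · exact rho_mem_pureBraidGroup
  · have key : ∀ g a b : QuaternionGroup 4, g ∈ quatHom.range → (a = .xa 0 ∨ a = .xa 4) →
        (b = .xa 2 ∨ b = .xa 6) → ∃ (m : Fin 4) (n : Fin 2), g = a ^ (m : ℕ) * b ^ (n : ℕ) := by
      decide
    obtain ⟨m, n, h⟩ := key _ _ _ ((mem_pureBraidGroup_iff β).1 hβ) deck_u deck_rho
    rw [← map_pow, ← map_pow, ← map_mul] at h
    rw [deck.injective h]
    have hu : u ∈ Subgroup.closure {u, rho} := Subgroup.subset_closure (Or.inl rfl)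
    have hr : rho ∈ Subgroup.closure {u, rho} := Subgroup.subset_closure (Or.inr rfl)
    exact mul_mem (pow_mem hu _) (pow_mem hr _)

theorem rho_conj_u : rho * u * rho⁻¹ = u⁻¹ := by
  refine deck.injective ?_
  simp only [map_mul, map_inv]
  rcases deck_rho with h | h <;> rcases deck_u with h' | h' <;> rw [h, h'] <;> decide

theorem rho_sq : rho ^ 2 = u ^ 2 := by
  refine deck.injective ?_
  simp only [map_pow]
  rcases deck_rho with h | h <;> rcases deck_u with h' | h' <;> rw [h, h'] <;> decide

theorem deck_rho_mul_u : deck (rho * u) = .a 2 ∨ deck (rho * u) = .a 6 := by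
  rw [map_mul]
  rcases deck_rho with h | h <;> rcases deck_u with h' | h' <;> rw [h, h'] <;> decide

theorem orderOf_rho_mul_u : orderOf (rho * u) = 4 := by
  have h4 : (rho * u) ^ 2 ^ 2 = 1 ∧ ¬ (rho * u) ^ 2 ^ 1 = 1 := by
    rw [← deck.injective.eq_iff, ← deck.injective.eq_iff, map_pow, map_pow, map_one]
    rcases deck_rho_mul_u with h | h <;> rw [h] <;> decide
  exact orderOf_eq_prime_pow h4.2 h4.1

theorem mem_zpowers_iff_deck {x β : BraidGroup rp2Arc 2} :
    β ∈ Subgroup.zpowers x ↔ ∃ m : Fin 8, deck β = deck x ^ (m : ℕ) := by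
  -- the exponent of the generalized quaternion group of order `16` is `8`
  have hx : x ^ 8 = 1 := by
    have key : ∀ g : QuaternionGroup 4, g ^ 8 = 1 := by decide
    exact deck.injective ((map_pow _ _ _).trans ((key _).trans (map_one _).symm))
  have hfin : IsOfFinOrder x := isOfFinOrder_iff_pow_eq_one.2 ⟨8, by decide, hx⟩
  rw [← hfin.mem_powers_iff_mem_zpowers, Submonoid.mem_powers_iff]
  constructor
  · rintro ⟨n, rfl⟩
    refine ⟨⟨n % 8, Nat.mod_lt _ (by decide)⟩, ?_⟩
    rw [pow_eq_pow_mod n hx, map_pow]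
  · rintro ⟨m, h⟩
    exact ⟨m, deck.injective ((map_pow _ _ _).trans h.symm)⟩

theorem mem_zpowers_rho_mul_u_iff {β : BraidGroup rp2Arc 2} :
    β ∈ Subgroup.zpowers (rho * u) ↔ ∃ m : Fin 4, deck β = .a 2 ^ (m : ℕ) := by
  have key : ∀ g b : QuaternionGroup 4, g = .a 2 ∨ g = .a 6 →
      ((∃ m : Fin 8, b = g ^ (m : ℕ)) ↔ ∃ m : Fin 4, b = .a 2 ^ (m : ℕ)) := by decide
  rw [mem_zpowers_iff_deck]
  exact key _ _ deck_rho_mul_u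

theorem mem_zpowers_rho_mul_u_sq_iff {β : BraidGroup rp2Arc 2} :
    β ∈ Subgroup.zpowers ((rho * u) ^ 2) ↔ deck β = 1 ∨ deck β = .a 4 := by
  have key : ∀ g b : QuaternionGroup 4, g = .a 2 ∨ g = .a 6 →
      ((∃ m : Fin 8, b = (g ^ 2) ^ (m : ℕ)) ↔ b = 1 ∨ b = .a 4) := by decide
  rw [mem_zpowers_iff_deck, map_pow]
  exact key _ _ deck_rho_mul_u

theorem mem_pureCohenBraids_iff {β : BraidGroup rp2Arc 2} :
    β ∈ pureCohenBraids rp2Arc 1 ↔ β ∈ Subgroup.zpowers (rho * u) := by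
  have key : ∀ g : QuaternionGroup 4, g ∈ quatHom.range ∧ dirSign 1 g = dirSign 0 g ↔
      ∃ m : Fin 4, g = .a 2 ^ (m : ℕ) := by decide
  rw [mem_zpowers_rho_mul_u_iff, ← key, ← mem_pureBraidGroup_iff, and_comm]
  refine and_congr_left fun hβ => ?_
  have h0 := signEquiv_removeStrand hβ 0
  have h1 := signEquiv_removeStrand hβ 1
  change _ = dirSign 1 _ at h0
  change _ = dirSign 0 _ at h1
  rw [← h0, ← h1, signEquiv.injective.eq_iff]
  refine ⟨fun h => h 0 1, fun h i j => ?_⟩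
  fin_cases i <;> fin_cases j
  exacts [rfl, h, h.symm, rfl]

theorem mem_pureBrunnianBraids_iff {β : BraidGroup rp2Arc 2} :
    β ∈ pureBrunnianBraids rp2Arc 1 ↔ β ∈ Subgroup.zpowers ((rho * u) ^ 2) := by
  have key : ∀ g : QuaternionGroup 4, (g ∈ quatHom.range ∧ dirSign 1 g = 1 ∧ dirSign 0 g = 1) ↔
      g = 1 ∨ g = .a 4 := by decide
  rw [mem_zpowers_rho_mul_u_sq_iff, ← key, ← mem_pureBraidGroup_iff]
  refine and_congr_right fun hβ => ?_
  have h0 := signEquiv_removeStrand hβ 0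
  have h1 := signEquiv_removeStrand hβ 1
  change _ = dirSign 1 _ at h0
  change _ = dirSign 0 _ at h1
  rw [← h0, ← h1, map_eq_one_iff _ signEquiv.injective, map_eq_one_iff _ signEquiv.injective]
  exact Fin.forall_fin_two

theorem zpowers_sq_le : Subgroup.zpowers ((rho * u) ^ 2) ≤ Subgroup.zpowers (rho * u) := by
  rw [Subgroup.zpowers_le]
  exact pow_mem (Subgroup.mem_zpowers _) 2

theorem zpowers_rho_mul_u_le : Subgroup.zpowers (rho * u) ≤ pureBraidGroup rp2Arc 2 := by
  rw [Subgroup.zpowers_le]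
  exact mul_mem rho_mem_pureBraidGroup u_mem_pureBraidGroup

/-- Every braid with one strand is pure, as the symmetric group on one letter is trivial. -/
theorem pureBraidGroup_one_eq_top {M : Type*} [TopologicalSpace M] [T2Space M] (e : BaseArc M) :
    pureBraidGroup e 1 = ⊤ := by
  refine (Subgroup.eq_top_iff' _).2 fun β => ?_
  have cov := (isQuotientCoveringMap_proj M 1).isCoveringMap
  have h1 := cov.map_liftPathQuotient (FundamentalGroup.toPath β) ⟨e.base 1, rfl⟩
  have h2 := (cov.monodromy (FundamentalGroup.toPath β) ⟨e.base 1, rfl⟩).2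
  have key : ∀ (y : Conf M 1) (P : Path.Homotopic.Quotient (e.base 1) y)
      (h : proj M 1 y = proj M 1 (e.base 1)),
      P.map (proj M 1) = (FundamentalGroup.toPath β).cast rfl h → β ∈ pureBraidGroup e 1 := by
    intro y P h hP
    obtain ⟨τ, rfl⟩ := proj_eq_iff.1 h
    obtain rfl := Subsingleton.elim τ 1
    exact ⟨FundamentalGroup.fromPath P, hP.trans (Path.Homotopic.Quotient.cast_rfl_rfl _)⟩
  exact key _ _ h2 h1

theorem nonempty_braidGroup_one_equiv :
    Nonempty (BraidGroup rp2Arc 1 ≃* Multiplicative (ZMod 2)) := by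
  have h : Nat.card ℤˣ = 2 := by rw [Nat.card_eq_fintype_card]; rfl
  have h2 : Nat.card (Multiplicative (ZMod 2)) = 2 := by rw [Nat.card_eq_fintype_card]; rfl
  exact ⟨signEquiv.trans (mulEquivOfPrimeCardEq h h2)⟩

/-- The removal of the first strand, as a homomorphism on the pure Cohen braids. -/
def removeStrandHom : Subgroup.zpowers (rho * u) →* BraidGroup rp2Arc 1 :=
  MonoidHom.mk' (fun β => removeStrand rp2Arc 0 β.1) fun β γ => by
    have key : ∀ g h : QuaternionGroup 4, g ∈ quatHom.range → h ∈ quatHom.range →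
      dirSign 1 (g * h) = dirSign 1 g * dirSign 1 h := by decide
    have hβ := zpowers_rho_mul_u_le β.2
    have hγ := zpowers_rho_mul_u_le γ.2
    refine signEquiv.injective ?_
    rw [map_mul, signEquiv_removeStrand hβ, signEquiv_removeStrand hγ,
      signEquiv_removeStrand (zpowers_rho_mul_u_le (β * γ).2), Subgroup.coe_mul, map_mul]
    exact key _ _ ((mem_pureBraidGroup_iff _).1 hβ) ((mem_pureBraidGroup_iff _).1 hγ)

theorem signEquiv_removeStrandHom (β : Subgroup.zpowers (rho * u)) :
    signEquiv (removeStrandHom β) = dirSign 1 (deck β.1) :=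
  signEquiv_removeStrand (zpowers_rho_mul_u_le β.2) 0

theorem surjective_removeStrandHom : Function.Surjective removeStrandHom := by
  intro x
  rcases Int.units_eq_one_or (signEquiv x) with h | h
  · refine ⟨1, signEquiv.injective ?_⟩
    rw [map_one, map_one, h]
  · refine ⟨⟨rho * u, Subgroup.mem_zpowers _⟩, signEquiv.injective ?_⟩
    rw [signEquiv_removeStrandHom, h]
    rcases deck_rho_mul_u with h | h <;> rw [h] <;> decide

theorem ker_removeStrandHom : removeStrandHom.ker =
    (Subgroup.zpowers ((rho * u) ^ 2)).subgroupOf (Subgroup.zpowers (rho * u)) := by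
  ext β
  have key : ∀ m : Fin 4, dirSign 1 (.a 2 ^ (m : ℕ)) = 1 ↔
      (.a 2 ^ (m : ℕ) : QuaternionGroup 4) = 1 ∨ (.a 2 ^ (m : ℕ) : QuaternionGroup 4) = .a 4 := by
    decide
  obtain ⟨m, hm⟩ := mem_zpowers_rho_mul_u_iff.1 β.2
  rw [MonoidHom.mem_ker, Subgroup.mem_subgroupOf, mem_zpowers_rho_mul_u_sq_iff,
    ← map_eq_one_iff _ signEquiv.injective, signEquiv_removeStrandHom, hm]
  exact key m

end SurfaceBraid
end

open SurfaceBraid in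
theorem mainTheorem9 :
    -- `P_2(ℝP²)` is the quaternion group of order 8, generated by `ρ` and `u`
    Nonempty (pureBraidGroup rp2Arc 2 ≃* QuaternionGroup 2) ∧
    Subgroup.closure {u, rho} = pureBraidGroup rp2Arc 2 ∧
    rho * u * rho⁻¹ = u⁻¹ ∧ rho ^ 2 = u ^ 2 ∧
    -- the pure Cohen braids and the pure Brunnian braids on two strands form subgroups `H`, `K`
    ∃ H K : Subgroup (BraidGroup rp2Arc 2),
      (H : Set (BraidGroup rp2Arc 2)) = pureCohenBraids rp2Arc 1 ∧
      (K : Set (BraidGroup rp2Arc 2)) = pureBrunnianBraids rp2Arc 1 ∧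
      H ≤ pureBraidGroup rp2Arc 2 ∧ K ≤ H ∧
      -- `H` is cyclic of order 4 with generator `ρ u`
      IsCyclic H ∧ Nat.card H = 4 ∧ H = Subgroup.zpowers (rho * u) ∧
      -- `K` has order 2
      Nat.card K = 2 ∧
      -- `1 → K → H → B_1(ℝP²) = P_1(ℝP²) ≅ ℤ/2 → 1` is exact, the second map being `d_1`
      pureBraidGroup rp2Arc 1 = ⊤ ∧
      Nonempty (BraidGroup rp2Arc 1 ≃* Multiplicative (ZMod 2)) ∧
      ∃ d : H →* BraidGroup rp2Arc 1,
        (∀ β : H, d β = removeStrand rp2Arc 0 β.1) ∧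
        Function.Surjective d ∧ d.ker = K.subgroupOf H := by
  refine ⟨⟨pureBraidGroupEquiv⟩, closure_u_rho, rho_conj_u, rho_sq, Subgroup.zpowers (rho * u),
    Subgroup.zpowers ((rho * u) ^ 2), Set.ext fun β => mem_pureCohenBraids_iff.symm,
    Set.ext fun β => mem_pureBrunnianBraids_iff.symm, zpowers_rho_mul_u_le, zpowers_sq_le,
    inferInstance, ?_, rfl, ?_, pureBraidGroup_one_eq_top rp2Arc, nonempty_braidGroup_one_equiv,
    removeStrandHom, fun _ => rfl, surjective_removeStrandHom, ker_removeStrandHom⟩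
  · rw [Nat.card_zpowers, orderOf_rho_mul_u]
  · rw [Nat.card_zpowers, orderOf_pow' _ two_ne_zero, orderOf_rho_mul_u]
    rfl
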